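/- Let $n\ge 1$, $q\in(0,2]$, let $\mathcal S^n$ be the space of real symmetric $n\times n$ matrices, and let $F:\mathbb R^n\times\mathcal S^n\to\mathbb R$ be continuous with $F(x,O)=0$ and $0\le F(x,X+Y)-F(x,X)\le \operatorname{tr}(Y)$ for all $x\in\mathbb R^n$ and $X,Y\in\mathcal S^n$ with $Y\ge O$. Let $f,g:\mathbb R\to\mathbb R$ be continuous, $f$ positive and strictly increasing, $g$ nondecreasing, and assume that $\lim_{t\to+\infty}f(t)=+\infty$ if $\lim_{t\to+\infty}g(t)<+\infty$. Write $g^{\pm}=\max\{\pm g,0\}$ and consider the conditions $$\text{(ns+)}\quad q\le 1\ \text{ and }\ \int_0^{+\infty}\frac{dt}{(t f(t))^{1/2}+(t g^+(t))^{1/(2-q)}}=+\infty,$$ $$\text{(ns0)}\quad \int_0^{+\infty}\frac{dt}{\psi_0(t)^{1/2}}=+\infty,\qquad \psi_a(t)=\int_a^t e^{-2\int_s^t\left(\frac{g^-(r)}{f(r)}\right)^{2/q}f(r)\,dr}f(s)\,ds,$$ $$\text{(ns}-\text{)}\quad \int_0^{+\infty}\left[\frac1{(t f(t))^{1/2}}+\frac1{f(t)^{1/q}}\right]dt=+\infty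 .$$ For $\mathcal R:\mathbb R\to(0,+\infty)$ strictly decreasing with $\lim_{a\to+\infty}\mathcal R(a)=0$ and $b>0$, let $\mathcal R^{-1}(b)$ be the unique real $a$ with $\mathcal R(a)=b$ if it exists, and $\mathcal R^{-1}(b)=-\infty$ otherwise. Let $\Omega\subset\mathbb R^n$ be an open set with nonempty boundary, $d(x)=\operatorname{dist}(x,\partial\Omega)$, and let $u:\Omega\to\mathbb R$ be an upper semicontinuous viscosity solution of $F(x,D^2u)\ge f(u)+g(u)|Du|^q$ in $\Omega$, that is, whenever $\varphi$ is $C^2$ near $x_0\in\Omega$ and $u-\varphi$ has a local maximum at $x_0$, one has $F(x_0,D^2\varphi(x_0))\ge f(u(x_0))+g(u(x_0))|D\varphi(x_0)|^q$. (i) If $\lim_{t\to+\infty}g(t)>0$ and (ns+) fails, then, for all $x\in\Omega$, $u(x)\le\max\{t_0,\mathcal R^{-1}(d(x))\}$, where $t_0=\inf\{t\in\mathbb R: g(t)\ge 0\}\in[-\infty,+\infty)$ and $$\mathcal R(a)=\begin{cases}\displaystyle 2\left(\frac n{2-q}\right)^{\frac1{2-q}}\int_a^{+\infty}\frac{dt}{\left(\int_a^t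 f(s)\,ds\right)^{1/2}+\left(\int_a^t g^+(s)\,ds\right)^{1/(2-q)}} & \text{if } q<2,\\[3ex] \displaystyle\sqrt{\frac n2}\int_a^{+\infty}\frac{dt}{\left(\int_a^t e^{\frac2n\int_s^t g^+(\tau)\,d\tau}f(s)\,ds\right)^{1/2}} & \text{if } q=2.\end{cases}$$ (ii) If $\lim_{t\to+\infty}g(t)=0$ and (ns0) fails, then, for all $x\in\Omega$, $u(x)\le\mathcal R^{-1}(d(x))$, where $$\mathcal R(a)=\frac{n^{1/q}}{\sqrt q}\int_a^{+\infty}\frac{dt}{\psi_a(t)^{1/2}}.$$ (iii) If $\lim_{t\to+\infty}g(t)<0$ and (ns$-$) fails, then, for all $x\in\Omega$, $u(x)\le\mathcal R^{-1}(d(x))$, where $$\mathcal R(a)=\frac{2n^{1/q}}{q}\int_a^{+\infty}\left[\frac1{\left(\int_a^t f(s)\,ds\right)^{1/2}}+\left(\frac{\int_a^t g^-(s)\,ds}{\int_a^t f(s)\,ds}\right)^{1/q}\right]dt .$$ In each of the three cases, $\mathcal R$ takes values in $(0,+\infty)$, is strictly decreasing and satisfies $\lim_{a\to+\infty}\mathcal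 R(a)=0$. (An inequality $u(x)\le-\infty$ is impossible for real-valued $u$; where it would be asserted, the conclusion is that no such $u$ exists.) -/

import Mathlib

open Filter Topology MeasureTheory
open scoped ENNReal

noncomputable section

namespace KellerOsserman

/-- The Euclidean space `ℝⁿ`. -/
abbrev Space (n : ℕ) : Type := EuclideanSpace ℝ (Fin n)

/-- The Hessian matrix `D²φ(x)`, with entries `∂ᵢ∂ⱼφ(x)` in the standard basis. -/
def hessian {n : ℕ} (φ : Space n → ℝ) (x : Space n) : Matrix (Fin n) (Fin n) ℝ :=
  fun i j => fderiv ℝ (fderiv ℝ φ) x (EuclideanSpace.single i 1) (EuclideanSpace.single j 1)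

/-- Continuous normalized degenerate elliptic operators `F : ℝⁿ × Sₙ → ℝ` with `F(x, O) = 0`.
Only the values `F x X` at symmetric matrices `X` are constrained. -/
structure IsDegenerateElliptic {n : ℕ}
    (F : Space n → Matrix (Fin n) (Fin n) ℝ → ℝ) : Prop where
  continuousOn : ContinuousOn (fun p : Space n × Matrix (Fin n) (Fin n) ℝ => F p.1 p.2)
    {p | p.2.IsSymm}
  map_zero : ∀ x, F x 0 = 0
  monotone : ∀ x (X Y : Matrix (Fin n) (Fin n) ℝ), X.IsSymm → Y.PosSemidef →
    0 ≤ F x (X + Y) - F x X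
  le_trace : ∀ x (X Y : Matrix (Fin n) (Fin n) ℝ), X.IsSymm → Y.PosSemidef →
    F x (X + Y) - F x X ≤ Y.trace

/-- `u ∈ USC(Ω)` is a viscosity solution of `F(x, D²u) ≥ f(u) + g(u) |Du|^q` in the open set `Ω`:
whenever `φ` is of class `C²` near `x₀ ∈ Ω` and `u - φ` has a local maximum at `x₀`, the inequality
holds at `x₀` with the derivatives of `φ` in place of those of `u`. -/
structure IsViscositySubsolution {n : ℕ} (F : Space n → Matrix (Fin n) (Fin n) ℝ → ℝ)
    (f g : ℝ → ℝ) (q : ℝ) (Ω : Set (Space n)) (u : Space n → ℝ) : Prop where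
  usc : UpperSemicontinuousOn u Ω
  test : ∀ x₀ ∈ Ω, ∀ φ : Space n → ℝ, ContDiffAt ℝ 2 φ x₀ →
    IsLocalMax (fun x => u x - φ x) x₀ →
      f (u x₀) + g (u x₀) * ‖gradient φ x₀‖ ^ q ≤ F x₀ (hessian φ x₀)

/-- `q ≤ 1` and `∫₀^∞ dt / ((t f(t))^{1/2} + (t g⁺(t))^{1/(2-q)}) = +∞`. -/
def ConditionPos (f g : ℝ → ℝ) (q : ℝ) : Prop :=
  q ≤ 1 ∧
  ∫⁻ t in Set.Ioi (0 : ℝ), ENNReal.ofReal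
    (1 / ((t * f t) ^ (1 / 2 : ℝ) + (t * (g t)⁺) ^ (1 / (2 - q)))) = ⊤

/-- `∫_a^t exp(-2 ∫_s^t (g⁻(r)/f(r))^{2/q} f(r) dr) f(s) ds`. -/
def dampedPrimitive (f g : ℝ → ℝ) (q a t : ℝ) : ℝ :=
  ∫ s in a..t, Real.exp (-2 * ∫ r in s..t, ((g r)⁻ / f r) ^ (2 / q) * f r) * f s

/-- `∫₀^∞ dt / (∫₀^t exp(-2 ∫_s^t (g⁻/f)^{2/q} f) f(s) ds)^{1/2} = +∞`. -/
def ConditionZero (f g : ℝ → ℝ) (q : ℝ) : Prop :=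
  ∫⁻ t in Set.Ioi (0 : ℝ), ENNReal.ofReal
    (1 / dampedPrimitive f g q 0 t ^ (1 / 2 : ℝ)) = ⊤

/-- `∫₀^∞ [1 / (t f(t))^{1/2} + 1 / f(t)^{1/q}] dt = +∞`. -/
def ConditionNeg (f : ℝ → ℝ) (q : ℝ) : Prop :=
  ∫⁻ t in Set.Ioi (0 : ℝ), ENNReal.ofReal
    (1 / (t * f t) ^ (1 / 2 : ℝ) + 1 / f t ^ (1 / q)) = ⊤

/-- The function `ℛ` for the case `lim g > 0`, with values in `[0, ∞]`. -/
def radiusPos (n : ℕ) (f g : ℝ → ℝ) (q a : ℝ) : ℝ≥0∞ :=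
  if q < 2 then
    ENNReal.ofReal (2 * ((n : ℝ) / (2 - q)) ^ (1 / (2 - q))) *
      ∫⁻ t in Set.Ioi a, ENNReal.ofReal
        (1 / ((∫ s in a..t, f s) ^ (1 / 2 : ℝ) + (∫ s in a..t, (g s)⁺) ^ (1 / (2 - q))))
  else
    ENNReal.ofReal (Real.sqrt ((n : ℝ) / 2)) *
      ∫⁻ t in Set.Ioi a, ENNReal.ofReal
        (1 / (∫ s in a..t, Real.exp (2 / (n : ℝ) * ∫ τ in s..t, (g τ)⁺) * f s) ^ (1 / 2 : ℝ))

/-- The function `ℛ` for the case `lim g = 0`, with values in `[0, ∞]`. -/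
def radiusZero (n : ℕ) (f g : ℝ → ℝ) (q a : ℝ) : ℝ≥0∞ :=
  ENNReal.ofReal ((n : ℝ) ^ (1 / q) / Real.sqrt q) *
    ∫⁻ t in Set.Ioi a, ENNReal.ofReal (1 / dampedPrimitive f g q a t ^ (1 / 2 : ℝ))

/-- The function `ℛ` for the case `lim g < 0`, with values in `[0, ∞]`. -/
def radiusNeg (n : ℕ) (f g : ℝ → ℝ) (q a : ℝ) : ℝ≥0∞ :=
  ENNReal.ofReal (2 * ((n : ℝ) ^ (1 / q) / q)) *
    ∫⁻ t in Set.Ioi a, ENNReal.ofReal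
      (1 / (∫ s in a..t, f s) ^ (1 / 2 : ℝ) +
        ((∫ s in a..t, (g s)⁻) / (∫ s in a..t, f s)) ^ (1 / q))

/-- `R` takes values in `(0, +∞)`, is strictly decreasing, and tends to `0` at `+∞`. -/
structure IsDecreasingToZero (R : ℝ → ℝ≥0∞) : Prop where
  pos : ∀ a, 0 < R a
  lt_top : ∀ a, R a < ⊤
  strictAnti : StrictAnti R
  tendsto_zero : Tendsto R atTop (𝓝 0)

open Classical in
/-- `R⁻¹(b)`: the unique real `a` with `R(a) = b` if it exists, and `-∞` otherwise. -/
def inverse (R : ℝ → ℝ≥0∞) (b : ℝ) : EReal :=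
  if h : ∃! a : ℝ, R a = ENNReal.ofReal b then ((h.choose : ℝ) : EReal) else ⊥

/-- `t₀ = inf {t ∈ ℝ : g(t) ≥ 0}`, which is `-∞` if `g ≥ 0` everywhere. -/
def threshold (g : ℝ → ℝ) : EReal := sInf ((fun t : ℝ => (t : EReal)) '' {t | 0 ≤ g t})

/-- Every viscosity solution `u` of `F(x, D²u) ≥ f(u) + g(u) |Du|^q` in an open set `Ω ⊆ ℝⁿ` with
nonempty boundary, for any admissible `F`, satisfies `u(x) ≤ B(dist(x, ∂Ω))` in `Ω`. -/
def HasUniversalBound (n : ℕ) (f g : ℝ → ℝ) (q : ℝ) (B : ℝ → EReal) : Prop :=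
  ∀ F : Space n → Matrix (Fin n) (Fin n) ℝ → ℝ, IsDegenerateElliptic F →
    ∀ Ω : Set (Space n), IsOpen Ω → (frontier Ω).Nonempty →
      ∀ u : Space n → ℝ, IsViscositySubsolution F f g q Ω u →
        ∀ x ∈ Ω, (u x : EReal) ≤ B (Metric.infDist x (frontier Ω))

end KellerOsserman

end

/-!
The bound comes from comparison with radial barriers on balls `B(x₀, T) ⊆ Ω`. A function
`v(x) = φ(|x - x₀|)` with `φ(0) = a` and `φ(r) → ∞` as `r → T` forces `u(x₀) ≤ a` as soon as it is a
supersolution. Indeed, if `u - v` had a positive maximum, `v` would be an admissible test function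
there, while `F(x, X)` is at most the sum of the positive parts of the eigenvalues of `X`; since `f`
is strictly increasing and `g` is nondecreasing, this is a contradiction
(`IsViscositySubsolution.le_of_barrier`).

The profile is found in the variable `t = φ`: writing `φ'² / 2 = w(φ)`, one has `φ'' = w'(φ)`, and
the blow-up radius is `∫_a^∞ dt / √(2 w(t))` (`exists_profile`, `exists_barrier_profile`). If
`w' ≤ k` with `k` nondecreasing, the mean value theorem gives `φ'(r)/r ≤ k(φ(r))`, so that the
supersolution property reduces to `max (w') 0 + (n - 1) k ≤ f + g (2w)^{q/2}`. No differential
equation has to be solved, because explicit functions `w` satisfy this inequality and have a blow-up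
radius at most `ℛ(a)`:

* for `g ≥ 0` and `q < 2`, the sum of `(1/n) ∫_a^t f` and of the solution of `n w' = g (2w)^{q/2}`
  (`le_of_radiusPos_lt`); for `q = 2`, the solution of a linear equation
  (`le_of_radiusPos_two_lt`);
* for `g ≤ 0`, a multiple of `ψ_a` (`le_of_radiusZero_lt`);
* for `g < 0`, a multiple of `(Φ⁻¹ + (H/Φ)^{2/q})⁻¹` with `Φ = ∫_a^t f` and `H = ∫_a^t g⁻`
  (`le_of_radiusNeg_lt`).

Hence `u(x) ≤ a` whenever `ℛ(a) < dist(x, ∂Ω)`. After the substitution `t = a + τ` the integrand of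
`ℛ` is continuous and strictly decreasing in `a` and tends to `0`; by dominated convergence so is
`ℛ` (`isDecreasingToZero_of_shift`). Continuity and the intermediate value theorem then turn the
family of bounds into `u(x) ≤ ℛ⁻¹(dist(x, ∂Ω))` (`le_max_inverse`). Finiteness of `ℛ` follows from
the failure of the Keller–Osserman condition, comparing `∫_a^t f` with `(t/2) f(t/2)` for large `t`.
-/

namespace KellerOsserman

/-! ### Degenerate elliptic operators -/

theorem posSemidef_smul_vecMulVec_add_smul_one {n : ℕ} (y : Space n) {α β : ℝ} (hβ : 0 ≤ β)
    (hαβ : 0 ≤ α * ‖y‖ ^ 2 + β) :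
    (α • Matrix.vecMulVec (y : Fin n → ℝ) y + β • (1 : Matrix (Fin n) (Fin n) ℝ)).PosSemidef := by
  have hsymm : (α • Matrix.vecMulVec (y : Fin n → ℝ) y +
      β • (1 : Matrix (Fin n) (Fin n) ℝ)).IsHermitian := by
    ext i j
    simp only [Matrix.conjTranspose_apply, Matrix.add_apply, Matrix.smul_apply,
      Matrix.vecMulVec_apply, Matrix.one_apply, star_trivial, smul_eq_mul, eq_comm (a := j)]
    ring
  refine Matrix.PosSemidef.of_dotProduct_mulVec_nonneg hsymm fun x => ?_
  have key : star x ⬝ᵥ ((α • Matrix.vecMulVec (y : Fin n → ℝ) y +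
      β • (1 : Matrix (Fin n) (Fin n) ℝ)).mulVec x)
      = α * ((y : Fin n → ℝ) ⬝ᵥ x) ^ 2 + β * (x ⬝ᵥ x) := by
    rw [Matrix.add_mulVec, Matrix.smul_mulVec, Matrix.smul_mulVec, Matrix.one_mulVec,
      Matrix.vecMulVec_mulVec, dotProduct_add, dotProduct_smul, dotProduct_smul, star_trivial]
    simp only [op_smul_eq_smul, dotProduct_smul, smul_eq_mul, dotProduct_comm x y]
    ring
  have hy : (y : Fin n → ℝ) ⬝ᵥ (y : Fin n → ℝ) = ‖y‖ ^ 2 := by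
    rw [EuclideanSpace.real_norm_sq_eq, dotProduct]
    exact Finset.sum_congr rfl fun i _ => (sq _).symm
  have hx0 : 0 ≤ x ⬝ᵥ x := Finset.sum_nonneg fun i _ => mul_self_nonneg (x i)
  have hcs : ((y : Fin n → ℝ) ⬝ᵥ x) ^ 2 ≤ ‖y‖ ^ 2 * (x ⬝ᵥ x) := by
    rw [← hy]
    simpa [dotProduct, sq] using Finset.sum_mul_sq_le_sq_mul_sq Finset.univ (y : Fin n → ℝ) x
  rw [key]
  rcases le_or_gt 0 α with hα | hα
  · positivity
  · nlinarith

theorem IsDegenerateElliptic.le_trace_of_le {n : ℕ}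
    {F : Space n → Matrix (Fin n) (Fin n) ℝ → ℝ} (hF : IsDegenerateElliptic F) (x : Space n)
    {X Z : Matrix (Fin n) (Fin n) ℝ} (hX : X.IsSymm) (hZ : Z.PosSemidef)
    (hXZ : (Z - X).PosSemidef) : F x X ≤ Z.trace := by
  have h1 := hF.monotone x X (Z - X) hX hXZ
  have h2 := hF.le_trace x 0 Z Matrix.isSymm_zero hZ
  rw [hF.map_zero, zero_add] at h2
  rw [add_sub_cancel] at h1
  linarith

/-- On a matrix with the simple eigenvalue `α ‖y‖² + β` in the direction `y` and the eigenvalue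
`β ≥ 0` on the orthogonal complement of `y`, a degenerate elliptic operator is at most the sum of
the positive parts of the eigenvalues. -/
theorem IsDegenerateElliptic.apply_rankOne_add_le {n : ℕ}
    {F : Space n → Matrix (Fin n) (Fin n) ℝ → ℝ} (hF : IsDegenerateElliptic F) (x : Space n)
    {y : Space n} (hy : y ≠ 0) {α β : ℝ} (hβ : 0 ≤ β) :
    F x (α • Matrix.vecMulVec (y : Fin n → ℝ) y + β • (1 : Matrix (Fin n) (Fin n) ℝ)) ≤
      max (α * ‖y‖ ^ 2 + β) 0 + (n - 1) * β := by
  have hy2 : 0 < ‖y‖ ^ 2 := by positivity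
  set m := max (α * ‖y‖ ^ 2 + β) 0 with hm
  have hyy : (y : Fin n → ℝ) ⬝ᵥ (y : Fin n → ℝ) = ‖y‖ ^ 2 := by
    rw [EuclideanSpace.real_norm_sq_eq, dotProduct]
    exact Finset.sum_congr rfl fun i _ => (sq _).symm
  -- The eigenvalue in the direction `y` is replaced by its positive part.
  have key := hF.le_trace_of_le x
    (X := α • Matrix.vecMulVec (y : Fin n → ℝ) y + β • (1 : Matrix (Fin n) (Fin n) ℝ))
    (Z := ((m - β) / ‖y‖ ^ 2) • Matrix.vecMulVec (y : Fin n → ℝ) y +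
      β • (1 : Matrix (Fin n) (Fin n) ℝ)) ?_ ?_ ?_
  · refine key.trans (le_of_eq ?_)
    rw [Matrix.trace_add, Matrix.trace_smul, Matrix.trace_smul, Matrix.trace_vecMulVec,
      hyy, Matrix.trace_one, Fintype.card_fin, smul_eq_mul, smul_eq_mul]
    field_simp
    ring
  · ext i j
    simp only [Matrix.transpose_apply, Matrix.add_apply, Matrix.smul_apply,
      Matrix.vecMulVec_apply, Matrix.one_apply, smul_eq_mul, eq_comm (a := j)]
    ring
  · refine posSemidef_smul_vecMulVec_add_smul_one y hβ ?_
    rw [div_mul_cancel₀ _ hy2.ne', sub_add_cancel]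
    exact le_max_right _ _
  · have : (((m - β) / ‖y‖ ^ 2) • Matrix.vecMulVec (y : Fin n → ℝ) y +
        β • (1 : Matrix (Fin n) (Fin n) ℝ)) - (α • Matrix.vecMulVec (y : Fin n → ℝ) y +
        β • (1 : Matrix (Fin n) (Fin n) ℝ)) = ((m - β) / ‖y‖ ^ 2 - α) •
        Matrix.vecMulVec (y : Fin n → ℝ) y + (0 : ℝ) • (1 : Matrix (Fin n) (Fin n) ℝ) := by
      rw [sub_smul, zero_smul]; abel
    rw [this]
    refine posSemidef_smul_vecMulVec_add_smul_one y le_rfl ?_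
    rw [sub_mul, div_mul_cancel₀ _ hy2.ne', add_zero]
    linarith [le_max_left (α * ‖y‖ ^ 2 + β) 0]

theorem IsDegenerateElliptic.apply_smul_one_le {n : ℕ}
    {F : Space n → Matrix (Fin n) (Fin n) ℝ → ℝ} (hF : IsDegenerateElliptic F) (x : Space n)
    {β : ℝ} (hβ : 0 ≤ β) : F x (β • (1 : Matrix (Fin n) (Fin n) ℝ)) ≤ n * β := by
  have key := hF.le_trace_of_le x (X := β • (1 : Matrix (Fin n) (Fin n) ℝ))
    (Z := β • (1 : Matrix (Fin n) (Fin n) ℝ)) (by simp [Matrix.IsSymm])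
    (Matrix.PosSemidef.one.smul hβ) (by simpa using Matrix.PosSemidef.zero)
  refine key.trans (le_of_eq ?_)
  rw [Matrix.trace_smul, Matrix.trace_one, Fintype.card_fin, smul_eq_mul, mul_comm]

/-! ### Derivatives of radial functions -/

/-- The Hessian of a function whose gradient is `c(x) (x - x₀)`. -/
theorem hessian_eq_of_hasFDerivAt {n : ℕ} {v c : Space n → ℝ} {x₀ x₁ : Space n}
    {c' : Space n →L[ℝ] ℝ}
    (hv : ∀ᶠ x in 𝓝 x₁, HasFDerivAt v (c x • innerSL ℝ (x - x₀)) x)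
    (hc : HasFDerivAt c c' x₁) (i j : Fin n) :
    hessian v x₁ i j = c' (EuclideanSpace.single i 1) * (x₁ - x₀) j +
      c x₁ * (1 : Matrix (Fin n) (Fin n) ℝ) i j := by
  have h1 : fderiv ℝ v =ᶠ[𝓝 x₁] fun x => c x • innerSL ℝ (x - x₀) :=
    hv.mono fun x hx => hx.fderiv
  have h2 : HasFDerivAt (fun x : Space n => innerSL ℝ (x - x₀)) (innerSL ℝ) x₁ := by
    have := ((innerSL ℝ (E := Space n)).hasFDerivAt (x := x₁ - x₀)).comp x₁
      ((hasFDerivAt_id x₁).sub_const x₀)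
    rwa [ContinuousLinearMap.comp_id] at this
  have h3 := (hc.smul h2).congr_of_eventuallyEq h1
  have h4 : innerSL ℝ (EuclideanSpace.single i (1 : ℝ)) (EuclideanSpace.single j (1 : ℝ)) =
      (1 : Matrix (Fin n) (Fin n) ℝ) i j := by
    rw [innerSL_apply_apply, EuclideanSpace.inner_single_left]
    simp [Matrix.one_apply]
  have h5 : innerSL ℝ (x₁ - x₀) (EuclideanSpace.single j (1 : ℝ)) = (x₁ - x₀) j := by
    rw [innerSL_apply_apply, EuclideanSpace.inner_single_right]
    simp
  rw [hessian, h3.fderiv]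
  change c x₁ * innerSL ℝ (EuclideanSpace.single i (1 : ℝ)) (EuclideanSpace.single j (1 : ℝ)) +
    c' (EuclideanSpace.single i 1) * innerSL ℝ (x₁ - x₀) (EuclideanSpace.single j (1 : ℝ)) = _
  rw [h4, h5, add_comm]

theorem norm_gradient_eq {n : ℕ} {v : Space n → ℝ} {x : Space n} {L : Space n →L[ℝ] ℝ}
    (hv : HasFDerivAt v L x) : ‖gradient v x‖ = ‖L‖ := by
  rw [gradient, hv.fderiv, LinearIsometryEquiv.norm_map]

theorem hasFDerivAt_norm_sub_sq {n : ℕ} (x₀ x : Space n) :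
    HasFDerivAt (fun x : Space n => ‖x - x₀‖ ^ 2) (2 • innerSL ℝ (x - x₀)) x := by
  have := (hasStrictFDerivAt_norm_sq (x - x₀)).hasFDerivAt.comp x
    ((hasFDerivAt_id x).sub_const x₀)
  rwa [ContinuousLinearMap.comp_id] at this

theorem hasFDerivAt_norm_sub {n : ℕ} {x₀ x : Space n} (hx : x ≠ x₀) :
    HasFDerivAt (fun x : Space n => ‖x - x₀‖) (‖x - x₀‖⁻¹ • innerSL ℝ (x - x₀)) x := by
  have hpos : 0 < ‖x - x₀‖ := norm_pos_iff.2 (sub_ne_zero.2 hx)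
  have h2 := (hasFDerivAt_norm_sub_sq x₀ x).sqrt (by positivity)
  simp only [Real.sqrt_sq (norm_nonneg _)] at h2
  have h3 : (1 / (2 * ‖x - x₀‖)) • 2 • innerSL ℝ (x - x₀) =
      ‖x - x₀‖⁻¹ • innerSL ℝ (x - x₀) := by
    rw [← Nat.cast_smul_eq_nsmul ℝ, smul_smul]
    congr 1
    push_cast
    field_simp
  rwa [h3] at h2

theorem hasFDerivAt_radial {n : ℕ} {φ : ℝ → ℝ} {p : ℝ} {x₀ x : Space n} (hx : x ≠ x₀)
    (hφ : HasDerivAt φ p ‖x - x₀‖) :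
    HasFDerivAt (fun x : Space n => φ ‖x - x₀‖) ((p / ‖x - x₀‖) • innerSL ℝ (x - x₀)) x := by
  have := hφ.comp_hasFDerivAt x (hasFDerivAt_norm_sub hx)
  rwa [smul_smul, ← div_eq_mul_inv] at this

theorem norm_gradient_radial {n : ℕ} {φ : ℝ → ℝ} {p : ℝ} {x₀ x : Space n} (hx : x ≠ x₀)
    (hφ : HasDerivAt φ p ‖x - x₀‖) (hp : 0 ≤ p) :
    ‖gradient (fun x : Space n => φ ‖x - x₀‖) x‖ = p := by
  have hpos : 0 < ‖x - x₀‖ := norm_pos_iff.2 (sub_ne_zero.2 hx)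
  rw [norm_gradient_eq (hasFDerivAt_radial hx hφ), norm_smul, innerSL_apply_norm, Real.norm_eq_abs,
    abs_of_nonneg (by positivity), div_mul_cancel₀ _ hpos.ne']

/-- The Hessian of `φ(|x - x₀|)` has the eigenvalue `φ''` in the radial direction and the
eigenvalue `φ'/|x - x₀|` in the tangential directions. -/
theorem hessian_radial {n : ℕ} {φ φ' : ℝ → ℝ} {p : ℝ} {x₀ x₁ : Space n} (hx : x₁ ≠ x₀)
    (hφ : ∀ᶠ r in 𝓝 ‖x₁ - x₀‖, HasDerivAt φ (φ' r) r) (hφ' : HasDerivAt φ' p ‖x₁ - x₀‖) :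
    hessian (fun x : Space n => φ ‖x - x₀‖) x₁ =
      ((p - φ' ‖x₁ - x₀‖ / ‖x₁ - x₀‖) / ‖x₁ - x₀‖ ^ 2) •
        Matrix.vecMulVec ((x₁ - x₀ : Space n) : Fin n → ℝ) (x₁ - x₀ : Space n) +
      (φ' ‖x₁ - x₀‖ / ‖x₁ - x₀‖) • (1 : Matrix (Fin n) (Fin n) ℝ) := by
  have hpos : 0 < ‖x₁ - x₀‖ := norm_pos_iff.2 (sub_ne_zero.2 hx)
  have hcont : Tendsto (fun x : Space n => ‖x - x₀‖) (𝓝 x₁) (𝓝 ‖x₁ - x₀‖) :=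
    (by fun_prop : Continuous fun x : Space n => ‖x - x₀‖).tendsto x₁
  have hv : ∀ᶠ x in 𝓝 x₁, HasFDerivAt (fun x : Space n => φ ‖x - x₀‖)
      ((φ' ‖x - x₀‖ / ‖x - x₀‖) • innerSL ℝ (x - x₀)) x := by
    filter_upwards [hcont.eventually hφ, isOpen_ne.mem_nhds hx] with x h1 h2
    exact hasFDerivAt_radial h2 h1
  have hc := hasFDerivAt_radial hx (hφ'.div (hasDerivAt_id' ‖x₁ - x₀‖) hpos.ne')
  ext i j
  rw [hessian_eq_of_hasFDerivAt hv hc]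
  have h5 : innerSL ℝ (x₁ - x₀) (EuclideanSpace.single i (1 : ℝ)) = (x₁ - x₀) i := by
    rw [innerSL_apply_apply, EuclideanSpace.inner_single_right]
    simp
  rw [Matrix.add_apply, Matrix.smul_apply, Matrix.smul_apply, Matrix.vecMulVec_apply,
    _root_.smul_apply, h5, smul_eq_mul, smul_eq_mul, smul_eq_mul]
  field_simp

theorem contDiffAt_radial {n : ℕ} {φ : ℝ → ℝ} {x₀ x₁ : Space n} (hx : x₁ ≠ x₀)
    (hφ : ContDiffAt ℝ 2 φ ‖x₁ - x₀‖) :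
    ContDiffAt ℝ 2 (fun x : Space n => φ ‖x - x₀‖) x₁ :=
  hφ.comp x₁ ((contDiffAt_id.sub contDiffAt_const).norm ℝ (sub_ne_zero.2 hx))

theorem hasFDerivAt_paraboloid {n : ℕ} (M : ℝ) (x₀ x : Space n) :
    HasFDerivAt (fun x : Space n => M / 2 * ‖x - x₀‖ ^ 2) (M • innerSL ℝ (x - x₀)) x := by
  have h2 := (hasFDerivAt_norm_sub_sq x₀ x).const_mul (M / 2)
  rwa [← Nat.cast_smul_eq_nsmul ℝ, smul_smul, Nat.cast_ofNat, div_mul_cancel₀ _ two_ne_zero] at h2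

theorem hessian_paraboloid {n : ℕ} (M : ℝ) (x₀ x₁ : Space n) :
    hessian (fun x : Space n => M / 2 * ‖x - x₀‖ ^ 2) x₁ =
      M • (1 : Matrix (Fin n) (Fin n) ℝ) := by
  ext i j
  rw [hessian_eq_of_hasFDerivAt (c := fun _ => M)
    (Eventually.of_forall fun x => hasFDerivAt_paraboloid M x₀ x) (hasFDerivAt_const M x₁)]
  simp

/-! ### Radial profiles -/

/-- The autonomous equation `φ' = p(φ)`, `φ(0) = a`, solved by inverting `t ↦ ∫_a^t dτ / p(τ)`. The
solution blows up at `T = ∫_a^∞ dτ / p(τ)`; the speed `p` may vanish at `a`. -/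
theorem exists_profile {p : ℝ → ℝ} {a T : ℝ} (hp : ∀ t, a < t → 0 < p t)
    (hpc : ContinuousOn p (Set.Ioi a)) (hint : IntegrableOn (fun t => 1 / p t) (Set.Ioi a))
    (hT : T = ∫ t in Set.Ioi a, 1 / p t) :
    0 < T ∧ ∃ φ : ℝ → ℝ, φ 0 = a ∧ StrictMonoOn φ (Set.Ico 0 T) ∧
      ContinuousOn φ (Set.Ico 0 T) ∧ (∀ r ∈ Set.Ioo 0 T, HasDerivAt φ (p (φ r)) r) ∧
      ∀ M, ∃ r ∈ Set.Ioo 0 T, M ≤ φ r := by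
  have hii : ∀ s t, a ≤ s → a ≤ t → IntervalIntegrable (fun t => 1 / p t) volume s t := by
    intro s t hs ht
    rw [intervalIntegrable_iff]
    exact hint.mono_set fun x hx => lt_of_le_of_lt (le_min hs ht) hx.1
  set Ψ : ℝ → ℝ := fun t => ∫ τ in a..t, 1 / p τ with hΨ
  have hΨa : Ψ a = 0 := intervalIntegral.integral_same
  have hmono : StrictMonoOn Ψ (Set.Ici a) := by
    intro s hs t ht hst
    have h1 : Ψ t - Ψ s = ∫ τ in s..t, 1 / p τ :=
      intervalIntegral.integral_interval_sub_left (hii a t le_rfl ht) (hii a s le_rfl hs)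
    have h2 : 0 < ∫ τ in s..t, 1 / p τ :=
      intervalIntegral.intervalIntegral_pos_of_pos_on (hii s t hs ht)
        (fun x hx => one_div_pos.2 (hp x (lt_of_le_of_lt hs hx.1))) hst
    linarith
  have hder : ∀ t, a < t → HasDerivAt Ψ (1 / p t) t := by
    intro t ht
    have hc : ContinuousOn (fun t => 1 / p t) (Set.Ioi a) :=
      continuousOn_const.div hpc fun x hx => (hp x hx).ne'
    exact intervalIntegral.integral_hasDerivAt_right (hii a t le_rfl ht.le)
      (hc.stronglyMeasurableAtFilter isOpen_Ioi t ht) (hc.continuousAt (Ioi_mem_nhds ht))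
  have hcont : ContinuousOn Ψ (Set.Ici a) := by
    intro t ht
    rcases (Set.mem_Ici.1 ht).eq_or_lt with rfl | h
    · have h1 : ContinuousOn Ψ (Set.uIcc a (a + 1)) := by
        refine intervalIntegral.continuousOn_primitive_interval ?_
        rw [Set.uIcc_of_le (by linarith), integrableOn_Icc_iff_integrableOn_Ioc]
        exact hint.mono_set Set.Ioc_subset_Ioi_self
      refine (h1 a Set.left_mem_uIcc).mono_of_mem_nhdsWithin ?_
      rw [Set.uIcc_of_le (by linarith)]
      exact Icc_mem_nhdsGE (by linarith)
    · exact (hder t h).continuousAt.continuousWithinAt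
  have hlim : Tendsto Ψ atTop (𝓝 T) :=
    hT ▸ intervalIntegral_tendsto_integral_Ioi a hint tendsto_id
  have hle : ∀ t, a ≤ t → Ψ t ≤ T := fun t ht =>
    ge_of_tendsto hlim ((eventually_ge_atTop t).mono fun s hs =>
      hmono.monotoneOn ht (ht.trans hs) hs)
  have hlt : ∀ t, a ≤ t → Ψ t < T := fun t ht =>
    (hmono ht (show a ≤ t + 1 by linarith) (by linarith)).trans_le (hle (t + 1) (by linarith))
  have hsurj : ∀ r ∈ Set.Ico 0 T, ∃ t ∈ Set.Ici a, Ψ t = r := by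
    intro r hr
    obtain ⟨b, hb1, hb2⟩ := ((hlim.eventually (lt_mem_nhds hr.2)).and
      (eventually_ge_atTop a)).exists
    obtain ⟨t, ht, htr⟩ := intermediate_value_Icc hb2 (hcont.mono fun x hx => hx.1)
      (show r ∈ Set.Icc (Ψ a) (Ψ b) from ⟨hΨa ▸ hr.1, hb1.le⟩)
    exact ⟨t, ht.1, htr⟩
  choose! φ hφmem hφ using hsurj
  have hT0 : 0 < T := hΨa ▸ hlt a le_rfl
  have hφΨ : ∀ t, a ≤ t → φ (Ψ t) = t := fun t ht => by
    have hm : Ψ t ∈ Set.Ico 0 T := ⟨hΨa ▸ hmono.monotoneOn Set.self_mem_Ici ht ht, hlt t ht⟩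
    exact hmono.injOn (hφmem _ hm) ht (hφ _ hm)
  have hΨpos : ∀ t, a < t → Ψ t ∈ Set.Ioo 0 T := fun t ht =>
    ⟨hΨa ▸ hmono Set.self_mem_Ici ht.le ht, hlt t ht.le⟩
  have hφmono : StrictMonoOn φ (Set.Ico 0 T) := by
    intro r hr s hs hrs
    rw [← hmono.lt_iff_lt (hφmem r hr) (hφmem s hs), hφ r hr, hφ s hs]
    exact hrs
  have hφ0 : φ 0 = a := by rw [← hΨa, hφΨ a le_rfl]
  have hφc : ∀ r ∈ Set.Ioo 0 T, ContinuousAt φ r := by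
    intro r hr
    have h1 : a < φ r := hφ0 ▸ hφmono ⟨le_rfl, hT0⟩ ⟨hr.1.le, hr.2⟩ hr.1
    refine (hφmono.mono Set.Ioo_subset_Ico_self).continuousAt_of_image_mem_nhds
      (Ioo_mem_nhds hr.1 hr.2) (mem_of_superset (Ioi_mem_nhds h1) fun t ht => ?_)
    exact ⟨Ψ t, hΨpos t ht, hφΨ t (le_of_lt ht)⟩
  refine ⟨hT0, φ, hφ0, hφmono, ?_, ?_, ?_⟩
  · intro r hr
    rcases hr.1.eq_or_lt with rfl | h
    · refine ContinuousWithinAt.mono ?_ Set.Ico_subset_Ici_self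
      refine hφmono.continuousWithinAt_right_of_surjOn (Ico_mem_nhdsGE hT0) fun t ht => ?_
      rw [hφ0] at ht
      exact ⟨Ψ t, Set.Ioo_subset_Ico_self (hΨpos t ht), hφΨ t (le_of_lt ht)⟩
    · exact (hφc r ⟨h, hr.2⟩).continuousWithinAt
  · intro r hr
    have h1 : a < φ r := hφ0 ▸ hφmono ⟨le_rfl, hT0⟩ ⟨hr.1.le, hr.2⟩ hr.1
    have h2 := HasDerivAt.of_local_left_inverse (hφc r hr) (hder _ h1)
      (one_div_pos.2 (hp _ h1)).ne'
      (Filter.Eventually.mono (Ioo_mem_nhds hr.1 hr.2) fun y hy =>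
        hφ y (Set.Ioo_subset_Ico_self hy))
    rwa [one_div, inv_inv] at h2
  · intro M
    have h1 : a < max M (a + 1) := lt_of_lt_of_le (by linarith) (le_max_right _ _)
    exact ⟨Ψ (max M (a + 1)), hΨpos _ h1, by rw [hφΨ _ h1.le]; exact le_max_left _ _⟩

/-- The profile `φ' = √(2 w(φ))` satisfies `φ'' = w'(φ)`. If `w' ≤ k` with `k` nondecreasing, then
`φ'(r)/r ≤ k(φ(r))`, and `φ` lies below every paraboloid of opening larger than `k(a)` near `0`. -/
theorem exists_barrier_profile {w w' k : ℝ → ℝ} {a T : ℝ}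
    (hw : ∀ t, a < t → HasDerivAt w (w' t) t) (hw'c : ContinuousOn w' (Set.Ioi a))
    (hwpos : ∀ t, a < t → 0 < w t) (hw0 : Tendsto w (𝓝[>] a) (𝓝 0))
    (hkmono : MonotoneOn k (Set.Ici a)) (hkc : ContinuousWithinAt k (Set.Ioi a) a)
    (hwk : ∀ t, a < t → w' t ≤ k t)
    (hint : IntegrableOn (fun t => 1 / Real.sqrt (2 * w t)) (Set.Ioi a))
    (hT : T = ∫ t in Set.Ioi a, 1 / Real.sqrt (2 * w t)) :
    0 < T ∧ ∃ φ φ' : ℝ → ℝ, φ 0 = a ∧ StrictMonoOn φ (Set.Ico 0 T) ∧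
      ContinuousOn φ (Set.Ico 0 T) ∧
      (∀ r ∈ Set.Ioo 0 T, φ' r = Real.sqrt (2 * w (φ r)) ∧ HasDerivAt φ (φ' r) r ∧
        HasDerivAt φ' (w' (φ r)) r ∧ ContDiffAt ℝ 2 φ r ∧ φ' r / r ≤ k (φ r)) ∧
      (∀ M, ∃ r ∈ Set.Ioo 0 T, M ≤ φ r) ∧
      ∀ M, k a < M → ∃ δ ∈ Set.Ioo 0 T, ∀ r ∈ Set.Icc 0 δ, φ r ≤ a + M / 2 * r ^ 2 := by
  have hsqrt : ∀ t, a < t → 0 < Real.sqrt (2 * w t) := fun t ht =>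
    Real.sqrt_pos.2 (mul_pos two_pos (hwpos t ht))
  have hsder : ∀ t, a < t →
      HasDerivAt (fun t => Real.sqrt (2 * w t)) (w' t / Real.sqrt (2 * w t)) t := by
    intro t ht
    have := ((hw t ht).const_mul 2).sqrt (mul_pos two_pos (hwpos t ht)).ne'
    convert this using 1
    have := hsqrt t ht
    field_simp
  obtain ⟨hT0, φ, hφ0, hφmono, hφc, hφd, hφtop⟩ := exists_profile hsqrt
    (fun t ht => (hsder t ht).continuousAt.continuousWithinAt) hint hT
  set φ' : ℝ → ℝ := fun r => if r = 0 then 0 else Real.sqrt (2 * w (φ r)) with hφ'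
  have hφ'eq : ∀ r ∈ Set.Ioo 0 T, φ' r = Real.sqrt (2 * w (φ r)) := fun r hr => if_neg hr.1.ne'
  have hφ'ev : ∀ r ∈ Set.Ioo 0 T, φ' =ᶠ[𝓝 r] fun r => Real.sqrt (2 * w (φ r)) := fun r hr => by
    filter_upwards [Ioo_mem_nhds hr.1 hr.2] with s hs using hφ'eq s hs
  have hgt : ∀ r ∈ Set.Ioo 0 T, a < φ r := fun r hr =>
    hφ0 ▸ hφmono ⟨le_rfl, hT0⟩ ⟨hr.1.le, hr.2⟩ hr.1
  have hd1 : ∀ r ∈ Set.Ioo 0 T, HasDerivAt φ (φ' r) r := fun r hr => by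
    rw [hφ'eq r hr]; exact hφd r hr
  have hd2 : ∀ r ∈ Set.Ioo 0 T, HasDerivAt φ' (w' (φ r)) r := fun r hr => by
    have h1 := (hsder _ (hgt r hr)).comp r (hφd r hr)
    rw [div_mul_cancel₀ _ (hsqrt _ (hgt r hr)).ne'] at h1
    exact h1.congr_of_eventuallyEq (hφ'ev r hr)
  have hφright : Tendsto φ (𝓝[>] 0) (𝓝[>] a) := by
    refine tendsto_nhdsWithin_iff.2 ⟨?_, ?_⟩
    · have h1 : ContinuousWithinAt φ (Set.Ico 0 T) 0 := hφc 0 ⟨le_rfl, hT0⟩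
      rw [ContinuousWithinAt, hφ0, nhdsWithin_Ico_eq_nhdsGE hT0] at h1
      exact h1.mono_left (nhdsWithin_mono _ Set.Ioi_subset_Ici_self)
    · filter_upwards [Ioo_mem_nhdsGT hT0] with r hr using hgt r hr
  have hφ'c0 : ContinuousWithinAt φ' (Set.Ici 0) 0 := by
    rw [← Set.Ioi_insert, continuousWithinAt_insert_self]
    have h1 : Tendsto (fun r => Real.sqrt (2 * w (φ r))) (𝓝[>] 0) (𝓝 (Real.sqrt (2 * 0))) :=
      (((hw0.comp hφright).const_mul 2).sqrt)
    rw [mul_zero, Real.sqrt_zero] at h1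
    rw [ContinuousWithinAt, show φ' 0 = 0 from if_pos rfl]
    refine h1.congr' ?_
    filter_upwards [Ioo_mem_nhdsGT hT0] with r hr using (hφ'eq r hr).symm
  have hφ'c : ContinuousOn φ' (Set.Ico 0 T) := by
    intro r hr
    rcases hr.1.eq_or_lt with rfl | h
    · exact hφ'c0.mono Set.Ico_subset_Ici_self
    · exact (hd2 r ⟨h, hr.2⟩).continuousAt.continuousWithinAt
  have hk : ∀ r ∈ Set.Ioo 0 T, φ' r / r ≤ k (φ r) := by
    intro r hr
    obtain ⟨ξ, hξ, hslope⟩ := exists_hasDerivAt_eq_slope φ' (fun s => w' (φ s)) hr.1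
      (hφ'c.mono fun s hs => ⟨hs.1, hs.2.trans_lt hr.2⟩)
      fun s hs => hd2 s ⟨hs.1, hs.2.trans hr.2⟩
    have hξT : ξ ∈ Set.Ioo 0 T := ⟨hξ.1, hξ.2.trans hr.2⟩
    have h0 : φ' 0 = 0 := if_pos rfl
    rw [h0, sub_zero, sub_zero] at hslope
    rw [← hslope]
    exact (hwk _ (hgt ξ hξT)).trans (hkmono (hgt ξ hξT).le (hgt r hr).le
      (hφmono ⟨hξT.1.le, hξT.2⟩ ⟨hr.1.le, hr.2⟩ hξ.2).le)
  refine ⟨hT0, φ, φ', hφ0, hφmono, hφc, fun r hr => ⟨hφ'eq r hr, hd1 r hr, hd2 r hr, ?_, hk r hr⟩,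
    hφtop, ?_⟩
  · have h1 : ContDiffOn ℝ (1 + 1) φ (Set.Ioo 0 T) := by
      rw [contDiffOn_succ_iff_deriv_of_isOpen isOpen_Ioo]
      refine ⟨fun s hs => (hd1 s hs).differentiableAt.differentiableWithinAt, by simp, ?_⟩
      have h2 : ContDiffOn ℝ (0 + 1) φ' (Set.Ioo 0 T) := by
        rw [contDiffOn_succ_iff_deriv_of_isOpen isOpen_Ioo]
        refine ⟨fun s hs => (hd2 s hs).differentiableAt.differentiableWithinAt, by simp, ?_⟩
        rw [contDiffOn_zero]
        refine ContinuousOn.congr (f := fun s => w' (φ s)) ?_ fun s hs => (hd2 s hs).deriv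
        exact hw'c.comp (hφc.mono Set.Ioo_subset_Ico_self) fun s hs => hgt s hs
      rw [zero_add] at h2
      exact h2.congr fun s hs => (hd1 s hs).deriv
    rw [one_add_one_eq_two] at h1
    exact h1.contDiffAt (Ioo_mem_nhds hr.1 hr.2)
  · intro M hM
    have h1 : ∀ᶠ r in 𝓝[>] 0, k (φ r) < M :=
      (hkc.tendsto.comp hφright).eventually (gt_mem_nhds hM)
    obtain ⟨ε, hε, hεM⟩ := (mem_nhdsGT_iff_exists_Ioo_subset).1 h1
    refine ⟨min ε T / 2, ⟨by have := lt_min (Set.mem_Ioi.1 hε) hT0; linarith, ?_⟩, ?_⟩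
    · have := min_le_right ε T; linarith
    intro r hr
    set δ := min ε T / 2
    have hδε : δ < ε := by
      have := min_le_left ε T; have := lt_min (Set.mem_Ioi.1 hε) hT0; simp only [δ]; linarith
    have hδT : δ < T := by
      have := min_le_right ε T; simp only [δ]; linarith
    have hanti : AntitoneOn (fun r => φ r - M / 2 * r ^ 2) (Set.Icc 0 δ) := by
      refine antitoneOn_of_hasDerivWithinAt_nonpos (f' := fun r => φ' r - M * r) (convex_Icc 0 δ)
        ((hφc.mono fun s hs => ⟨hs.1, hs.2.trans_lt hδT⟩).sub (by fun_prop)) ?_ ?_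
      · intro s hs
        rw [interior_Icc] at hs
        have h2 := (hd1 s ⟨hs.1, hs.2.trans hδT⟩).sub
          (((hasDerivAt_pow 2 s).const_mul (M / 2)))
        refine (h2.congr_deriv ?_).hasDerivWithinAt
        push_cast
        ring
      · intro s hs
        rw [interior_Icc] at hs
        have h2 := hk s ⟨hs.1, hs.2.trans hδT⟩
        have h3 : k (φ s) < M := hεM ⟨hs.1, hs.2.trans hδε⟩
        rw [div_le_iff₀ hs.1] at h2
        have := mul_le_mul_of_nonneg_right h3.le hs.1.le
        linarith
    have h4 := hanti ⟨le_rfl, hr.1.trans hr.2⟩ hr hr.1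
    simp only [hφ0] at h4
    linarith

/-! ### Comparison with radial barriers -/

theorem ball_infDist_frontier_subset {n : ℕ} {Ω : Set (Space n)} (hΩ : IsOpen Ω) {x : Space n}
    (hx : x ∈ Ω) : Metric.ball x (Metric.infDist x (frontier Ω)) ⊆ Ω := by
  intro y hy
  have hpos : 0 < Metric.infDist x (frontier Ω) := Metric.pos_of_mem_ball hy
  have hdisj : ∀ z ∈ Metric.ball x (Metric.infDist x (frontier Ω)), z ∉ frontier Ω := by
    intro z hz hzf
    have h1 := Metric.infDist_le_dist_of_mem hzf (x := x)
    rw [Metric.mem_ball, dist_comm] at hz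
    linarith
  by_contra hyΩ
  obtain ⟨z, -, hz1, hz2⟩ := (convex_ball x (Metric.infDist x (frontier Ω))).isPreconnected
    Ω (closure Ω)ᶜ hΩ isClosed_closure.isOpen_compl
    (fun z hz => or_iff_not_imp_left.2 fun h1 h2 =>
      hdisj z hz ⟨h2, fun h => h1 (interior_subset h)⟩)
    ⟨x, Metric.mem_ball_self hpos, hx⟩
    ⟨y, hy, fun h => hdisj y hy ⟨h, fun h' => hyΩ (interior_subset h')⟩⟩
  exact hz2 (subset_closure hz1)

/-- Comparison on a ball with a radial barrier that blows up on the boundary: the contact of `u`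
with the barrier from below cannot take place at a point where `u` is the larger of the two, by the
strict monotonicity of `f`. -/
theorem IsViscositySubsolution.le_of_barrier {n : ℕ} (hn : 1 ≤ n) {q : ℝ} (hq0 : 0 < q)
    {f g : ℝ → ℝ} (hfmono : StrictMono f) (hgmono : Monotone g) {w w' k : ℝ → ℝ} {a : ℝ}
    (hw : ∀ t, a < t → HasDerivAt w (w' t) t) (hw'c : ContinuousOn w' (Set.Ioi a))
    (hwpos : ∀ t, a < t → 0 < w t) (hw0 : Tendsto w (𝓝[>] a) (𝓝 0))
    (hkmono : MonotoneOn k (Set.Ici a)) (hkc : ContinuousWithinAt k (Set.Ioi a) a)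
    (hk0 : 0 ≤ k a) (hka : n * k a ≤ f a) (hwk : ∀ t, a < t → w' t ≤ k t)
    (hsuper : ∀ t, a < t → max (w' t) 0 + (n - 1) * k t ≤ f t + g t * (2 * w t) ^ (q / 2))
    {F : Space n → Matrix (Fin n) (Fin n) ℝ → ℝ} (hF : IsDegenerateElliptic F)
    {Ω : Set (Space n)} {u : Space n → ℝ} (hu : IsViscositySubsolution F f g q Ω u)
    {x₀ : Space n} {d : ℝ} (hball : Metric.ball x₀ d ⊆ Ω)
    (hT : ∫⁻ t in Set.Ioi a, ENNReal.ofReal (1 / Real.sqrt (2 * w t)) < ENNReal.ofReal d) :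
    u x₀ ≤ a := by
  have hn1 : (0 : ℝ) ≤ n - 1 := by
    have : (1 : ℝ) ≤ n := by exact_mod_cast hn
    linarith
  have hnonneg : ∀ t, 0 ≤ 1 / Real.sqrt (2 * w t) := fun t => by positivity
  have hmeas : AEStronglyMeasurable (fun t => 1 / Real.sqrt (2 * w t))
      (volume.restrict (Set.Ioi a)) := by
    refine ContinuousOn.aestronglyMeasurable ?_ measurableSet_Ioi
    refine continuousOn_const.div (Real.continuous_sqrt.comp_continuousOn (continuousOn_const.mul
      fun t ht => (hw t ht).continuousAt.continuousWithinAt)) fun t ht => ?_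
    exact (Real.sqrt_pos.2 (mul_pos two_pos (hwpos t ht))).ne'
  have hint : IntegrableOn (fun t => 1 / Real.sqrt (2 * w t)) (Set.Ioi a) := by
    refine ⟨hmeas, ?_⟩
    rw [hasFiniteIntegral_iff_ofReal (Eventually.of_forall hnonneg)]
    exact hT.trans ENNReal.ofReal_lt_top
  obtain ⟨hT0, φ, φ', hφ0, hφmono, hφc, hφd, hφtop, hφpar⟩ :=
    exists_barrier_profile hw hw'c hwpos hw0 hkmono hkc hwk hint rfl
  set T := ∫ t in Set.Ioi a, 1 / Real.sqrt (2 * w t) with hTdef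
  have hTd : T < d := by
    rw [← ofReal_integral_eq_lintegral_ofReal hint (Eventually.of_forall hnonneg)] at hT
    exact (ENNReal.ofReal_lt_ofReal_iff_of_nonneg hT0.le).1 hT
  have hcball : Metric.closedBall x₀ T ⊆ Ω := fun y hy =>
    hball (Metric.mem_ball.2 ((Metric.mem_closedBall.1 hy).trans_lt hTd))
  have hx₀ : x₀ ∈ Metric.closedBall x₀ T := Metric.mem_closedBall_self hT0.le
  by_contra! hlt
  obtain ⟨z, -, hz⟩ := UpperSemicontinuousOn.exists_isMaxOn ⟨x₀, hx₀⟩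
    (isCompact_closedBall x₀ T) (hu.usc.mono hcball)
  -- Beyond the radius `r₁` the barrier exceeds every value of `u`.
  obtain ⟨r₁, hr₁, hr₁u⟩ := hφtop (u z)
  set v : Space n → ℝ := fun x => φ ‖x - x₀‖ with hv
  have hsub : Metric.closedBall x₀ r₁ ⊆ Metric.closedBall x₀ T :=
    Metric.closedBall_subset_closedBall hr₁.2.le
  have hvc : ContinuousOn v (Metric.closedBall x₀ r₁) := by
    refine hφc.comp (by fun_prop) fun x hx => ⟨norm_nonneg _, ?_⟩
    rw [mem_closedBall_iff_norm] at hx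
    exact hx.trans_lt hr₁.2
  have husc : UpperSemicontinuousOn (fun x => u x - v x) (Metric.closedBall x₀ r₁) := by
    have h1 := (hu.usc.mono (hsub.trans hcball)).add hvc.neg.upperSemicontinuousOn
    exact h1
  obtain ⟨y, hy, hymax⟩ := UpperSemicontinuousOn.exists_isMaxOn
    ⟨x₀, Metric.mem_closedBall_self hr₁.1.le⟩ (isCompact_closedBall x₀ r₁) husc
  have hyx₀ : u x₀ - a ≤ u y - v y := by
    have := hymax (Metric.mem_closedBall_self hr₁.1.le)
    simpa [hv, hφ0] using this
  have hyr : ‖y - x₀‖ ≤ r₁ := mem_closedBall_iff_norm.1 hy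
  have hyr' : ‖y - x₀‖ < r₁ := by
    refine lt_of_le_of_ne hyr fun h => ?_
    have h1 : v y = φ r₁ := by simp only [hv, h]
    have h2 : u y ≤ u z := hz (hsub hy)
    linarith
  have hyΩ : y ∈ Ω := hcball (hsub hy)
  have hlocal : IsLocalMax (fun x => u x - v x) y := by
    filter_upwards [Metric.isOpen_ball.mem_nhds (mem_ball_iff_norm.2 hyr')] with x hx
    exact hymax (Metric.ball_subset_closedBall hx)
  rcases eq_or_ne y x₀ with rfl | hne
  · -- At the center the barrier is replaced by paraboloids.
    have hbound : ∀ M, k a < M → f (u y) ≤ n * M := by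
      intro M hM
      obtain ⟨δ, hδ, hδM⟩ := hφpar M hM
      have hmax : IsLocalMax (fun x => u x - M / 2 * ‖x - y‖ ^ 2) y := by
        filter_upwards [hlocal, Metric.isOpen_ball.mem_nhds (Metric.mem_ball_self hδ.1)]
          with x hx hxδ
        have h1 := hδM ‖x - y‖ ⟨norm_nonneg _, (mem_ball_iff_norm.1 hxδ).le⟩
        simp only [hv, sub_self, norm_zero, hφ0] at hx ⊢
        linarith
      have h1 := hu.test y hyΩ (fun x => M / 2 * ‖x - y‖ ^ 2) (contDiff_const.mul
        ((contDiff_id.sub contDiff_const).norm_sq ℝ)).contDiffAt hmax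
      have hgrad : ‖gradient (fun x : Space n => M / 2 * ‖x - y‖ ^ 2) y‖ = 0 := by
        rw [norm_gradient_eq (hasFDerivAt_paraboloid M y y)]
        simp
      rw [hgrad, Real.zero_rpow hq0.ne', mul_zero, add_zero, hessian_paraboloid] at h1
      exact h1.trans (hF.apply_smul_one_le y (hk0.trans hM.le))
    have h2 : f (u y) ≤ n * k a := by
      refine le_of_forall_pos_le_add fun ε hε => ?_
      have hnpos : (0 : ℝ) < n := by exact_mod_cast hn
      have := hbound (k a + ε / n) (by linarith [div_pos hε hnpos])
      rw [mul_add, mul_div_cancel₀ _ hnpos.ne'] at this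
      exact this
    exact absurd (h2.trans hka) (not_le.2 (hfmono hlt))
  · set r := ‖y - x₀‖ with hr
    have hrpos : 0 < r := norm_pos_iff.2 (sub_ne_zero.2 hne)
    have hrT : r ∈ Set.Ioo 0 T := ⟨hrpos, hyr'.trans hr₁.2⟩
    obtain ⟨hφ'eq, hd1, hd2, hC2, hkr⟩ := hφd r hrT
    have hφ'0 : 0 ≤ φ' r := hφ'eq ▸ Real.sqrt_nonneg _
    have hφa : a < φ r := hφ0 ▸ hφmono ⟨le_rfl, hT0⟩ ⟨hrpos.le, hrT.2⟩ hrpos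
    have h1 := hu.test y hyΩ v (contDiffAt_radial hne hC2) hlocal
    rw [norm_gradient_radial hne hd1 hφ'0, hessian_radial hne ?_ hd2] at h1
    · have h2 := h1.trans (hF.apply_rankOne_add_le y (sub_ne_zero.2 hne)
        (div_nonneg hφ'0 hrpos.le))
      rw [div_mul_cancel₀ _ (by positivity), sub_add_cancel] at h2
      have h3 := hsuper (φ r) hφa
      have hpow : φ' r ^ q = (2 * w (φ r)) ^ (q / 2) := by
        rw [hφ'eq, Real.sqrt_eq_rpow, ← Real.rpow_mul (by linarith [hwpos _ hφa])]
        congr 1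
        ring
      have hvu : φ r < u y := by
        have : v y = φ r := rfl
        linarith
      have h4 := hfmono hvu
      have h5 : g (φ r) * φ' r ^ q ≤ g (u y) * φ' r ^ q :=
        mul_le_mul_of_nonneg_right (hgmono hvu.le) (Real.rpow_nonneg hφ'0 q)
      have h6 := mul_le_mul_of_nonneg_left hkr hn1
      rw [← hpow] at h3
      linarith
    · filter_upwards [Ioo_mem_nhds hrT.1 hrT.2] with s hs using (hφd s hs).2.1

/-! ### The radius as a function of the center value -/

/-- After the substitution `t = a + τ` the radius becomes an integral over a fixed half-line whose
integrand is strictly decreasing in `a`, so that dominated convergence applies. -/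
theorem isDecreasingToZero_of_shift {R : ℝ → ℝ≥0∞} {J : ℝ → ℝ → ℝ} {C : ℝ≥0∞} (hC0 : C ≠ 0)
    (hCtop : C ≠ ⊤) (hR : ∀ a, R a = C * ∫⁻ t in Set.Ioi a, ENNReal.ofReal (J a t))
    (hpos : ∀ a τ, 0 < τ → 0 < J a (a + τ))
    (hanti : ∀ τ, 0 < τ → StrictAnti fun a => J a (a + τ))
    (hcont : ∀ τ, 0 < τ → Continuous fun a => J a (a + τ))
    (hmeas : ∀ a, ContinuousOn (J a) (Set.Ioi a))
    (hlim : ∀ τ, 0 < τ → Tendsto (fun a => J a (a + τ)) atTop (𝓝 0))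
    (hfin : ∀ a, ∫⁻ t in Set.Ioi a, ENNReal.ofReal (J a t) < ⊤) :
    IsDecreasingToZero R ∧ Continuous R := by
  set I : ℝ → ℝ≥0∞ := fun a => ∫⁻ τ in Set.Ioi (0 : ℝ), ENNReal.ofReal (J a (a + τ)) with hI
  have hshift : ∀ a, ∫⁻ t in Set.Ioi a, ENNReal.ofReal (J a t) = I a := by
    intro a
    rw [hI]
    simp only
    rw [← lintegral_indicator measurableSet_Ioi, ← lintegral_indicator measurableSet_Ioi,
      ← lintegral_add_left_eq_self _ a]
    refine lintegral_congr fun τ => ?_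
    by_cases h : 0 < τ
    · rw [Set.indicator_of_mem (show a + τ ∈ Set.Ioi a from lt_add_of_pos_right a h),
        Set.indicator_of_mem (show τ ∈ Set.Ioi 0 from h)]
    · rw [Set.indicator_of_notMem (show a + τ ∉ Set.Ioi a from
          fun h' => h (pos_of_lt_add_right h')),
        Set.indicator_of_notMem (show τ ∉ Set.Ioi 0 from h)]
  have hRI : ∀ a, R a = C * I a := fun a => by rw [hR, hshift]
  have hIfin : ∀ a, I a ≠ ⊤ := fun a => hshift a ▸ (hfin a).ne
  have hm : ∀ a, AEMeasurable (fun τ => ENNReal.ofReal (J a (a + τ)))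
      (volume.restrict (Set.Ioi (0 : ℝ))) := by
    intro a
    refine ((ContinuousOn.aemeasurable ?_ measurableSet_Ioi)).ennreal_ofReal
    exact (hmeas a).comp (by fun_prop) fun τ hτ => lt_add_of_pos_right a hτ
  have hvol : (volume.restrict (Set.Ioi (0 : ℝ))) ≠ 0 := by
    rw [Ne, Measure.restrict_eq_zero, Real.volume_Ioi]
    exact ENNReal.top_ne_zero
  have hIanti : StrictAnti I := by
    intro a b hab
    refine lintegral_strict_mono hvol (hm a) (hIfin b) ?_
    filter_upwards [ae_restrict_mem measurableSet_Ioi] with τ hτ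
    exact (ENNReal.ofReal_lt_ofReal_iff (hpos a τ hτ)).2 (hanti τ hτ hab)
  have hIcont : Continuous I := by
    rw [continuous_iff_continuousAt]
    intro a
    refine tendsto_lintegral_filter_of_dominated_convergence'
      (fun τ => ENNReal.ofReal (J (a - 1) (a - 1 + τ))) (Eventually.of_forall hm) ?_ (hIfin _) ?_
    · filter_upwards [Ioi_mem_nhds (show a - 1 < a by linarith)] with b hb
      filter_upwards [ae_restrict_mem measurableSet_Ioi] with τ hτ
      exact ENNReal.ofReal_le_ofReal ((hanti τ hτ).antitone (le_of_lt hb))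
    · filter_upwards [ae_restrict_mem measurableSet_Ioi] with τ hτ
      exact (ENNReal.continuous_ofReal.comp (hcont τ hτ)).tendsto a
  have hIlim : Tendsto I atTop (𝓝 0) := by
    have h1 : Tendsto I atTop (𝓝 (∫⁻ _ in Set.Ioi (0 : ℝ), 0)) := by
      refine tendsto_lintegral_filter_of_dominated_convergence'
        (fun τ => ENNReal.ofReal (J 0 (0 + τ))) (Eventually.of_forall hm) ?_ (hIfin _) ?_
      · filter_upwards [eventually_ge_atTop 0] with b hb
        filter_upwards [ae_restrict_mem measurableSet_Ioi] with τ hτ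
        exact ENNReal.ofReal_le_ofReal ((hanti τ hτ).antitone hb)
      · filter_upwards [ae_restrict_mem measurableSet_Ioi] with τ hτ
        have := (ENNReal.continuous_ofReal.tendsto 0).comp (hlim τ hτ)
        rwa [ENNReal.ofReal_zero] at this
    rwa [lintegral_zero] at h1
  have hReq : R = fun a => C * I a := funext hRI
  have hRanti : StrictAnti R := fun a b hab => by
    rw [hRI, hRI]
    exact ENNReal.mul_lt_mul_right hC0 hCtop (hIanti hab)
  refine ⟨⟨fun a => ?_, fun a => ?_, hRanti, ?_⟩, ?_⟩
  · exact zero_le.trans_lt (hRanti (lt_add_one a))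
  · rw [hRI]
    exact ENNReal.mul_lt_top hCtop.lt_top (hIfin a).lt_top
  · rw [hReq]
    simpa using ENNReal.Tendsto.const_mul hIlim (Or.inr hCtop)
  · rw [hReq]
    exact ENNReal.continuous_const_mul hCtop |>.comp hIcont

theorem inverse_eq_of_strictAnti {R : ℝ → ℝ≥0∞} (hR : StrictAnti R) {a b : ℝ}
    (hab : R a = ENNReal.ofReal b) : inverse R b = a := by
  have h : ∃! a : ℝ, R a = ENNReal.ofReal b :=
    ⟨a, hab, fun c hc => hR.injective (hc.trans hab.symm)⟩
  rw [inverse, dif_pos h]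
  exact congrArg _ (hR.injective (h.choose_spec.1.trans hab.symm))

/-- An upper bound by every admissible `a` with `R(a) < b` is an upper bound by `R⁻¹(b)`. The
continuity of `R` excludes values `b` that `R` skips. -/
theorem le_max_inverse {R : ℝ → ℝ≥0∞} (hR : IsDecreasingToZero R) (hRc : Continuous R) {b v : ℝ}
    (hb : 0 < b) {s : EReal} (h : ∀ a : ℝ, s < a → R a < ENNReal.ofReal b → v ≤ a) :
    (v : EReal) ≤ max s (inverse R b) := by
  by_contra! hlt
  obtain ⟨hs, hi⟩ := max_lt_iff.1 hlt
  rcases lt_or_ge (R v) (ENNReal.ofReal b) with hv | hv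
  · have h1 : ∀ᶠ a : ℝ in 𝓝 v, s < a ∧ R a < ENNReal.ofReal b :=
      ((continuous_coe_real_ereal.tendsto v).eventually (lt_mem_nhds hs)).and
        ((hRc.tendsto v).eventually (gt_mem_nhds hv))
    obtain ⟨a, ⟨ha1, ha2⟩, hav⟩ :=
      ((h1.filter_mono nhdsWithin_le_nhds).and (self_mem_nhdsWithin (s := Set.Iio v))).exists
    exact absurd (h a ha1 ha2) (not_le.2 hav)
  · obtain ⟨c, hc1, hc2⟩ := ((hR.tendsto_zero.eventually
      (gt_mem_nhds (ENNReal.ofReal_pos.2 hb))).and (eventually_ge_atTop v)).exists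
    obtain ⟨a, ha, hab⟩ := intermediate_value_Icc' hc2 hRc.continuousOn
      (show ENNReal.ofReal b ∈ Set.Icc (R c) (R v) from ⟨hc1.le, hv⟩)
    rw [inverse_eq_of_strictAnti hR.strictAnti hab] at hi
    exact absurd (EReal.coe_lt_coe_iff.1 hi) (not_lt.2 ha.1)

/-- The universal bound follows once every level `a` above the threshold `s` carries a barrier with
value `a` at the center and blow-up radius at most `R(a)`. -/
theorem HasUniversalBound.of_barriers {n : ℕ} {f g : ℝ → ℝ} {q : ℝ} {R : ℝ → ℝ≥0∞}
    (hR : IsDecreasingToZero R) (hRc : Continuous R) (s : EReal)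
    (h : ∀ a : ℝ, s < a → ∀ F : Space n → Matrix (Fin n) (Fin n) ℝ → ℝ, IsDegenerateElliptic F →
      ∀ (Ω : Set (Space n)) (u : Space n → ℝ), IsViscositySubsolution F f g q Ω u →
        ∀ x d, Metric.ball x d ⊆ Ω → R a < ENNReal.ofReal d → u x ≤ a) :
    HasUniversalBound n f g q fun d => max s (inverse R d) := by
  intro F hF Ω hΩ hΩne u hu x hx
  refine le_max_inverse hR hRc ?_ fun a ha hRa =>
    h a ha F hF Ω u hu x _ (ball_infDist_frontier_subset hΩ hx) hRa
  refine (isClosed_frontier.notMem_iff_infDist_pos hΩne).1 fun hxf => ?_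
  exact hxf.2 (hΩ.interior_eq.symm ▸ hx)

/-! ### Primitives -/

theorem integral_shift (f : ℝ → ℝ) (a τ : ℝ) :
    ∫ s in a..a + τ, f s = ∫ σ in (0 : ℝ)..τ, f (a + σ) := by
  rw [intervalIntegral.integral_comp_add_left, add_zero]

theorem hasDerivAt_integral {f : ℝ → ℝ} (hf : Continuous f) (a t : ℝ) :
    HasDerivAt (fun t => ∫ s in a..t, f s) (f t) t :=
  (hf.integral_hasStrictDerivAt a t).hasDerivAt

theorem continuous_integral {f : ℝ → ℝ} (hf : Continuous f) (a : ℝ) :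
    Continuous fun t => ∫ s in a..t, f s :=
  continuous_iff_continuousAt.2 fun t => (hasDerivAt_integral hf a t).continuousAt

theorem continuous_integral_shift {f : ℝ → ℝ} (hf : Continuous f) (τ : ℝ) :
    Continuous fun a => ∫ s in a..a + τ, f s := by
  have h : (fun a => ∫ s in a..a + τ, f s) =
      fun a => (∫ s in (0 : ℝ)..a + τ, f s) - ∫ s in (0 : ℝ)..a, f s := by
    funext a
    rw [intervalIntegral.integral_interval_sub_left] <;> exact hf.intervalIntegrable _ _
  rw [h]
  exact ((continuous_integral hf 0).comp (by fun_prop)).sub (continuous_integral hf 0)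

theorem mul_le_integral_of_monotone {f : ℝ → ℝ} (hf : Continuous f) (hmono : Monotone f)
    {a t : ℝ} (hat : a ≤ t) : (t - a) * f a ≤ ∫ s in a..t, f s := by
  have h : ∫ _ in a..t, f a ≤ ∫ s in a..t, f s :=
    intervalIntegral.integral_mono_on hat (by simp) (hf.intervalIntegrable _ _)
      fun s hs => hmono hs.1
  simpa using h

theorem integral_le_mul_of_antitone {f : ℝ → ℝ} (hf : Continuous f) (hanti : Antitone f)
    {a t : ℝ} (hat : a ≤ t) : ∫ s in a..t, f s ≤ (t - a) * f a := by
  have h : ∫ s in a..t, f s ≤ ∫ _ in a..t, f a :=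
    intervalIntegral.integral_mono_on hat (hf.intervalIntegrable _ _) (by simp)
      fun s hs => hanti hs.1
  simpa using h

theorem mul_le_integral_of_antitone {f : ℝ → ℝ} (hf : Continuous f) (hanti : Antitone f)
    {a t : ℝ} (hat : a ≤ t) : (t - a) * f t ≤ ∫ s in a..t, f s := by
  have h : ∫ _ in a..t, f t ≤ ∫ s in a..t, f s :=
    intervalIntegral.integral_mono_on hat (by simp) (hf.intervalIntegrable _ _)
      fun s hs => hanti hs.2
  simpa using h

theorem integral_le_mul_of_monotone {f : ℝ → ℝ} (hf : Continuous f) (hmono : Monotone f)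
    {a t : ℝ} (hat : a ≤ t) : ∫ s in a..t, f s ≤ (t - a) * f t := by
  have h : ∫ s in a..t, f s ≤ ∫ _ in a..t, f t :=
    intervalIntegral.integral_mono_on hat (hf.intervalIntegrable _ _) (by simp)
      fun s hs => hmono hs.2
  simpa using h

theorem integral_pos_of_pos {f : ℝ → ℝ} (hf : Continuous f) (hpos : ∀ t, 0 < f t) {a t : ℝ}
    (hat : a < t) : 0 < ∫ s in a..t, f s :=
  intervalIntegral.intervalIntegral_pos_of_pos_on (hf.intervalIntegrable _ _)
    (fun s _ => hpos s) hat

theorem integral_nonneg_of_nonneg {f : ℝ → ℝ} (hnonneg : ∀ t, 0 ≤ f t) {a t : ℝ}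
    (hat : a ≤ t) : 0 ≤ ∫ s in a..t, f s :=
  intervalIntegral.integral_nonneg hat fun s _ => hnonneg s

theorem strictMono_integral_shift {f : ℝ → ℝ} (hf : Continuous f) (hmono : StrictMono f) {τ : ℝ}
    (hτ : 0 < τ) : StrictMono fun a => ∫ s in a..a + τ, f s := by
  intro a b hab
  simp only [integral_shift]
  refine intervalIntegral.integral_lt_integral_of_continuousOn_of_le_of_exists_lt hτ
    (by fun_prop) (by fun_prop) (fun σ _ => (hmono (by linarith)).le) ⟨0, ⟨le_rfl, hτ.le⟩, ?_⟩
  exact hmono (by linarith)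

theorem monotone_integral_shift {f : ℝ → ℝ} (hf : Continuous f) (hmono : Monotone f) {τ : ℝ}
    (hτ : 0 ≤ τ) : Monotone fun a => ∫ s in a..a + τ, f s := by
  intro a b hab
  simp only [integral_shift]
  exact intervalIntegral.integral_mono_on hτ
    (by apply Continuous.intervalIntegrable; fun_prop)
    (by apply Continuous.intervalIntegrable; fun_prop) fun σ _ => hmono (by linarith)

/-- For large `t` the integral over `(a, t)` is controlled from below by the value at `t/2`. -/
theorem half_mul_le_integral {f : ℝ → ℝ} (hf : Continuous f) (hmono : Monotone f)
    (hnonneg : ∀ t, 0 ≤ f t) {a t : ℝ} (ht : 0 ≤ t) (hat : a ≤ t / 2) :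
    t / 2 * f (t / 2) ≤ ∫ s in a..t, f s := by
  have h1 := mul_le_integral_of_monotone hf hmono (show t / 2 ≤ t by linarith)
  have h2 : (∫ s in a..t / 2, f s) + ∫ s in t / 2..t, f s = ∫ s in a..t, f s :=
    intervalIntegral.integral_add_adjacent_intervals (hf.intervalIntegrable _ _)
      (hf.intervalIntegrable _ _)
  have h3 := integral_nonneg_of_nonneg hnonneg hat
  rw [show t - t / 2 = t / 2 by ring] at h1
  linarith

/-- The solution `∫_a^t exp(∫_s^t κ) f(s) ds` of `D' = f + κ D`, `D(a) = 0`. -/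
noncomputable def linearSolution (κ f : ℝ → ℝ) (a t : ℝ) : ℝ :=
  ∫ s in a..t, Real.exp (∫ r in s..t, κ r) * f s

theorem linearSolution_eq {κ f : ℝ → ℝ} (hκ : Continuous κ) (a t : ℝ) :
    linearSolution κ f a t = Real.exp (∫ r in (0 : ℝ)..t, κ r) *
      ∫ s in a..t, Real.exp (-∫ r in (0 : ℝ)..s, κ r) * f s := by
  rw [linearSolution, ← intervalIntegral.integral_const_mul]
  refine intervalIntegral.integral_congr fun s _ => ?_
  rw [← mul_assoc, ← Real.exp_add, ← sub_eq_add_neg,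
    intervalIntegral.integral_interval_sub_left (hκ.intervalIntegrable _ _)
      (hκ.intervalIntegrable _ _)]

theorem linearSolution_self (κ f : ℝ → ℝ) (a : ℝ) : linearSolution κ f a a = 0 :=
  intervalIntegral.integral_same

theorem hasDerivAt_linearSolution {κ f : ℝ → ℝ} (hκ : Continuous κ) (hf : Continuous f)
    (a t : ℝ) :
    HasDerivAt (linearSolution κ f a) (f t + κ t * linearSolution κ f a t) t := by
  have hA : Continuous fun s => Real.exp (-∫ r in (0 : ℝ)..s, κ r) * f s :=
    (Real.continuous_exp.comp (continuous_integral hκ 0).neg).mul hf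
  have h := (hasDerivAt_integral hκ 0 t).exp.mul (hasDerivAt_integral hA a t)
  have heq : linearSolution κ f a = fun t => Real.exp (∫ r in (0 : ℝ)..t, κ r) *
      ∫ s in a..t, Real.exp (-∫ r in (0 : ℝ)..s, κ r) * f s :=
    funext fun t => linearSolution_eq hκ a t
  rw [heq]
  refine h.congr_deriv ?_
  have h1 : Real.exp (∫ r in (0 : ℝ)..t, κ r) * Real.exp (-∫ r in (0 : ℝ)..t, κ r) = 1 := by
    rw [← Real.exp_add, add_neg_cancel, Real.exp_zero]
  linear_combination f t * h1

theorem continuous_linearSolution {κ f : ℝ → ℝ} (hκ : Continuous κ) (hf : Continuous f)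
    (a : ℝ) : Continuous (linearSolution κ f a) :=
  continuous_iff_continuousAt.2 fun t => (hasDerivAt_linearSolution hκ hf a t).continuousAt

theorem continuous_integrand_linearSolution {κ f : ℝ → ℝ} (hκ : Continuous κ)
    (hf : Continuous f) (t : ℝ) : Continuous fun s => Real.exp (∫ r in s..t, κ r) * f s := by
  have h : (fun s => ∫ r in s..t, κ r) = fun s => -∫ r in t..s, κ r :=
    funext fun s => intervalIntegral.integral_symm _ _
  exact (Real.continuous_exp.comp (h ▸ (continuous_integral hκ t).neg)).mul hf

theorem linearSolution_pos {κ f : ℝ → ℝ} (hκ : Continuous κ) (hf : Continuous f)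
    (hfpos : ∀ t, 0 < f t) {a t : ℝ} (hat : a < t) : 0 < linearSolution κ f a t :=
  integral_pos_of_pos (continuous_integrand_linearSolution hκ hf t)
    (fun s => mul_pos (Real.exp_pos _) (hfpos s)) hat

theorem linearSolution_shift (κ f : ℝ → ℝ) (a τ : ℝ) :
    linearSolution κ f a (a + τ) =
      linearSolution (fun r => κ (a + r)) (fun r => f (a + r)) 0 τ := by
  rw [linearSolution, integral_shift, linearSolution]
  refine intervalIntegral.integral_congr fun σ _ => ?_
  rw [intervalIntegral.integral_comp_add_left]

theorem linearSolution_mono {κ f : ℝ → ℝ} (hκ : Continuous κ) (hf : Continuous f)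
    (hfpos : ∀ t, 0 < f t) {a b : ℝ} (t : ℝ) (hab : a ≤ b) :
    linearSolution κ f b t ≤ linearSolution κ f a t := by
  have hc := continuous_integrand_linearSolution hκ hf t
  have h2 : (∫ s in a..b, Real.exp (∫ r in s..t, κ r) * f s) +
      ∫ s in b..t, Real.exp (∫ r in s..t, κ r) * f s =
      ∫ s in a..t, Real.exp (∫ r in s..t, κ r) * f s :=
    intervalIntegral.integral_add_adjacent_intervals (hc.intervalIntegrable _ _)
      (hc.intervalIntegrable _ _)
  have h3 := integral_nonneg_of_nonneg
    (fun s => (mul_pos (Real.exp_pos (∫ r in s..t, κ r)) (hfpos s)).le) hab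
  rw [linearSolution, linearSolution]
  linarith

theorem strictMono_linearSolution_shift {κ f : ℝ → ℝ} (hκ : Continuous κ) (hf : Continuous f)
    (hκmono : Monotone κ) (hfpos : ∀ t, 0 < f t) (hfmono : StrictMono f) {τ : ℝ} (hτ : 0 < τ) :
    StrictMono fun a => linearSolution κ f a (a + τ) := by
  intro a b hab
  simp only [linearSolution_shift]
  have hc : ∀ c, Continuous fun σ => Real.exp (∫ r in σ..τ, κ (c + r)) * f (c + σ) := fun c =>
    continuous_integrand_linearSolution (κ := fun r => κ (c + r)) (f := fun r => f (c + r))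
      (by fun_prop) (by fun_prop) τ
  have hexp : ∀ σ ≤ τ, Real.exp (∫ r in σ..τ, κ (a + r)) ≤ Real.exp (∫ r in σ..τ, κ (b + r)) :=
    fun σ hσ => Real.exp_le_exp.2 (intervalIntegral.integral_mono_on hσ
      (by apply Continuous.intervalIntegrable; fun_prop)
      (by apply Continuous.intervalIntegrable; fun_prop) fun r _ => hκmono (by linarith))
  refine intervalIntegral.integral_lt_integral_of_continuousOn_of_le_of_exists_lt hτ
    (hc a).continuousOn (hc b).continuousOn (fun σ hσ => ?_) ⟨0, ⟨le_rfl, hτ.le⟩, ?_⟩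
  · exact mul_le_mul (hexp σ hσ.2) (hfmono (by linarith)).le (hfpos _).le (Real.exp_pos _).le
  · exact mul_lt_mul' (hexp 0 hτ.le) (hfmono (by linarith)) (hfpos _).le (Real.exp_pos _)

theorem continuous_linearSolution_shift {κ f : ℝ → ℝ} (hκ : Continuous κ) (hf : Continuous f)
    (τ : ℝ) : Continuous fun a => linearSolution κ f a (a + τ) := by
  simp only [linearSolution_eq hκ]
  refine (Real.continuous_exp.comp ((continuous_integral hκ 0).comp (by fun_prop))).mul ?_
  exact continuous_integral_shift
    ((Real.continuous_exp.comp (continuous_integral hκ 0).neg).mul hf) τ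

/-- Lower bound for the solution when `κ ≥ c` on `[a, t]`. -/
theorem le_linearSolution {κ f : ℝ → ℝ} (hκ : Continuous κ) (hf : Continuous f)
    (hκmono : Monotone κ) (hfpos : ∀ t, 0 < f t) (hfmono : Monotone f) {a t c : ℝ} (hat : a ≤ t)
    (hc : c ≤ κ a) : f a * ∫ s in a..t, Real.exp (c * (t - s)) ≤ linearSolution κ f a t := by
  rw [mul_comm, ← intervalIntegral.integral_mul_const]
  refine intervalIntegral.integral_mono_on hat
    (by apply Continuous.intervalIntegrable; fun_prop)
    ((continuous_integrand_linearSolution hκ hf t).intervalIntegrable _ _) fun s hs => ?_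
  refine mul_le_mul (Real.exp_le_exp.2 ?_) (hfmono hs.1) (hfpos _).le (Real.exp_pos _).le
  have h1 := mul_le_integral_of_monotone hκ hκmono hs.2
  have h2 := mul_le_mul_of_nonneg_left (hc.trans (hκmono hs.1)) (sub_nonneg.2 hs.2)
  linarith

theorem mul_exp_le_linearSolution {κ f : ℝ → ℝ} (hκ : Continuous κ) (hf : Continuous f)
    (hκmono : Monotone κ) (hfpos : ∀ t, 0 < f t) (hfmono : Monotone f) {a t c : ℝ} (hat : a ≤ t)
    (hc : c ≤ κ a) :
    f a * ((t - a) * Real.exp (-|c| * (t - a))) ≤ linearSolution κ f a t := by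
  refine le_trans (mul_le_mul_of_nonneg_left ?_ (hfpos a).le)
    (le_linearSolution hκ hf hκmono hfpos hfmono hat hc)
  have h : ∫ _ in a..t, Real.exp (-|c| * (t - a)) ≤ ∫ s in a..t, Real.exp (c * (t - s)) := by
    refine intervalIntegral.integral_mono_on hat (by simp)
      (by apply Continuous.intervalIntegrable; fun_prop) fun s hs => Real.exp_le_exp.2 ?_
    have h1 := neg_abs_le c
    have h2 := abs_nonneg c
    nlinarith [hs.1, hs.2]
  simpa using h

theorem tendsto_linearSolution_shift {κ f : ℝ → ℝ} (hκ : Continuous κ) (hf : Continuous f)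
    (hκmono : Monotone κ) (hfpos : ∀ t, 0 < f t) (hfmono : Monotone f)
    (hlim : Tendsto f atTop atTop ∨ Tendsto κ atTop atTop) {τ : ℝ} (hτ : 0 < τ) :
    Tendsto (fun a => linearSolution κ f a (a + τ)) atTop atTop := by
  rcases hlim with h | h
  · refine tendsto_atTop_mono' atTop ?_
      (h.atTop_mul_const (r := τ * Real.exp (-|κ 0| * τ)) (by positivity))
    filter_upwards [eventually_ge_atTop 0] with a ha
    have := mul_exp_le_linearSolution hκ hf hκmono hfpos hfmono (show a ≤ a + τ by linarith)
      (hκmono ha)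
    rwa [add_sub_cancel_left] at this
  · have h1 : Tendsto (fun a => f 0 * (κ a * (τ ^ 2 / 2))) atTop atTop :=
      (h.atTop_mul_const (by positivity)).const_mul_atTop (hfpos 0)
    refine tendsto_atTop_mono' atTop ?_ h1
    filter_upwards [eventually_ge_atTop 0, h.eventually_ge_atTop 0] with a ha hκa
    refine le_trans ?_ (le_linearSolution hκ hf hκmono hfpos hfmono
      (show a ≤ a + τ by linarith) le_rfl)
    refine mul_le_mul (hfmono ha) ?_ (by positivity) (hfpos a).le
    have h2 : ∫ s in a..a + τ, κ a * (a + τ - s) ≤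
        ∫ s in a..a + τ, Real.exp (κ a * (a + τ - s)) := by
      refine intervalIntegral.integral_mono_on (by linarith)
        (by apply Continuous.intervalIntegrable; fun_prop)
        (by apply Continuous.intervalIntegrable; fun_prop) fun s _ => ?_
      linarith [Real.add_one_le_exp (κ a * (a + τ - s))]
    refine le_trans (le_of_eq ?_) h2
    rw [intervalIntegral.integral_const_mul,
      intervalIntegral.integral_comp_sub_left (fun x => x) (a + τ)]
    simp

/-! ### Integrability of the radius integrands -/

theorem integrableOn_Ioi_of_le {J h : ℝ → ℝ} {a T C : ℝ} (haT : a ≤ T)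
    (hJc : ContinuousOn J (Set.Ioi a)) (hJ0 : ∀ t, a < t → 0 ≤ J t)
    (hnear : ∀ t, a < t → t ≤ T → J t ≤ C * (t - a) ^ (-(1 / 2) : ℝ))
    (hfar : ∀ t, T < t → J t ≤ h t) (hh : IntegrableOn h (Set.Ioi T)) :
    IntegrableOn J (Set.Ioi a) := by
  rw [← Set.Ioc_union_Ioi_eq_Ioi haT]
  refine IntegrableOn.union ?_ ?_
  · have h1 : IntegrableOn (fun t => C * (t - a) ^ (-(1 / 2) : ℝ)) (Set.Ioc a T) := by
      rw [← intervalIntegrable_iff_integrableOn_Ioc_of_le haT]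
      have := (intervalIntegral.intervalIntegrable_rpow' (a := 0) (b := T - a)
        (show (-1 : ℝ) < -(1 / 2) by norm_num)).comp_sub_right a
      simp only [zero_add, sub_add_cancel] at this
      exact this.const_mul C
    refine Integrable.mono' h1 ((hJc.mono Set.Ioc_subset_Ioi_self).aestronglyMeasurable
      measurableSet_Ioc) ?_
    filter_upwards [ae_restrict_mem measurableSet_Ioc] with t ht
    rw [Real.norm_of_nonneg (hJ0 t ht.1)]
    exact hnear t ht.1 ht.2
  · refine Integrable.mono' hh ((hJc.mono (Set.Ioi_subset_Ioi haT)).aestronglyMeasurable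
      measurableSet_Ioi) ?_
    filter_upwards [ae_restrict_mem measurableSet_Ioi] with t ht
    rw [Real.norm_of_nonneg (hJ0 t (haT.trans_lt ht))]
    exact hfar t ht

/-- Linear growth of the primitive at `a` makes the singularity of the radius integrand
integrable. -/
theorem one_div_rpow_half_le {D c t a : ℝ} (hc : 0 < c) (hat : a < t) (h : c * (t - a) ≤ D) :
    1 / D ^ (1 / 2 : ℝ) ≤ 1 / c ^ (1 / 2 : ℝ) * (t - a) ^ (-(1 / 2) : ℝ) := by
  have ht : 0 < t - a := sub_pos.2 hat
  have h0 : 0 < c * (t - a) := mul_pos hc ht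
  rw [Real.rpow_neg ht.le, ← one_div, one_div_mul_one_div, ← Real.mul_rpow hc.le ht.le]
  exact one_div_le_one_div_of_le (Real.rpow_pos_of_pos h0 _)
    (Real.rpow_le_rpow h0.le h (by norm_num))

theorem integrableOn_of_lintegral_ne_top {J : ℝ → ℝ} {a : ℝ} (hJc : ContinuousOn J (Set.Ioi a))
    (hJ0 : ∀ t, a < t → 0 ≤ J t) (h : ∫⁻ t in Set.Ioi a, ENNReal.ofReal (J t) ≠ ⊤) :
    IntegrableOn J (Set.Ioi a) := by
  refine ⟨hJc.aestronglyMeasurable measurableSet_Ioi, ?_⟩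
  rw [hasFiniteIntegral_iff_ofReal]
  · exact h.lt_top
  · filter_upwards [ae_restrict_mem measurableSet_Ioi] with t ht using hJ0 t ht

/-- The dilation `t ↦ t/2` preserves integrability near infinity. -/
theorem integrableOn_comp_half {J : ℝ → ℝ} (h : IntegrableOn J (Set.Ioi 0)) {T : ℝ} (hT : 0 ≤ T) :
    IntegrableOn (fun t => J (t / 2)) (Set.Ioi T) := by
  have h1 := (integrableOn_Ioi_comp_mul_left_iff J 0 (show (0 : ℝ) < 1 / 2 by norm_num)).2
    (by simpa using h)
  refine (h1.mono_set (Set.Ioi_subset_Ioi hT)).congr_fun (fun t _ => ?_) measurableSet_Ioi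
  simp only
  congr 1
  ring

/-! ### Explicit barriers -/

theorem one_div_sqrt_le {X B : ℝ} (hB : 0 ≤ B) (h : 1 / X ≤ B ^ 2) : 1 / Real.sqrt X ≤ B := by
  rw [one_div, ← Real.sqrt_inv, ← one_div]
  exact Real.sqrt_le_iff.2 ⟨hB, h⟩

theorem lintegral_lt_of_le_const_mul {w J : ℝ → ℝ} {a C : ℝ} {b : ℝ≥0∞} (hC : 0 ≤ C)
    (h : ∀ t, a < t → 1 / Real.sqrt (2 * w t) ≤ C * J t)
    (hb : ENNReal.ofReal C * ∫⁻ t in Set.Ioi a, ENNReal.ofReal (J t) < b) :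
    ∫⁻ t in Set.Ioi a, ENNReal.ofReal (1 / Real.sqrt (2 * w t)) < b := by
  refine lt_of_le_of_lt ?_ hb
  rw [← lintegral_const_mul' _ _ ENNReal.ofReal_ne_top]
  refine setLIntegral_mono' measurableSet_Ioi fun t ht => ?_
  rw [← ENNReal.ofReal_mul hC]
  exact ENNReal.ofReal_le_ofReal (h t ht)

theorem rpow_le_one_add_mul_sub {x θ : ℝ} (hx : 0 ≤ x) (h0 : 0 ≤ θ) (h1 : θ ≤ 1) :
    x ^ θ ≤ 1 + θ * (x - 1) := by
  have := rpow_one_add_le_one_add_mul_self (show -1 ≤ x - 1 by linarith) h0 h1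
  rwa [add_sub_cancel] at this

/-- With `x = 2 - q` this compares the constants of the two terms in the radius for `q < 2`, so that
the larger one serves for both. -/
theorem sqrt_half_le {x n : ℝ} (hn : 1 ≤ n) (hx0 : 0 < x) (hx2 : x ≤ 2) :
    (n / 2) ^ (1 / 2 : ℝ) ≤ (n / x) ^ (1 / x) := by
  have hn0 : 0 < n := by linarith
  have key : (n / 2) ^ (x / 2) ≤ n / x := by
    have h1 : (2 : ℝ) ^ (1 - x / 2) ≤ 1 + (1 - x / 2) * (2 - 1) :=
      rpow_le_one_add_mul_sub (by norm_num) (by linarith) (by linarith)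
    have h2 : (n / 2) ^ (x / 2) = n ^ (x / 2) * 2 ^ (1 - x / 2) / 2 := by
      rw [Real.div_rpow hn0.le (by norm_num), Real.rpow_sub (by norm_num), Real.rpow_one]
      field_simp
    have h3 : n ^ (x / 2) ≤ n := by
      simpa using Real.rpow_le_rpow_of_exponent_le hn (show x / 2 ≤ 1 by linarith)
    rw [h2, le_div_iff₀ hx0]
    have h4 : n ^ (x / 2) * 2 ^ (1 - x / 2) ≤ n * (2 - x / 2) :=
      mul_le_mul h3 (by linarith) (by positivity) hn0.le
    nlinarith [mul_nonneg hn0.le (sq_nonneg (x - 2))]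
  have h := Real.rpow_le_rpow (by positivity) key (show 0 ≤ 1 / x by positivity)
  rwa [← Real.rpow_mul (by positivity), show x / 2 * (1 / x) = 1 / 2 by field_simp] at h

section Barriers

variable {n : ℕ} {q : ℝ} {f g h : ℝ → ℝ} {a d : ℝ}
  {F : Space n → Matrix (Fin n) (Fin n) ℝ → ℝ} {Ω : Set (Space n)} {u : Space n → ℝ} {x₀ : Space n}

/-- For `g ≥ 0` and `q < 2`, with `K = (2 - q)/n ∫_a^t g`, the choice
`w = (1/n) ∫_a^t f + (1/2) K^{2/(2-q)}` satisfies `n w' = f + g K^{q/(2-q)} ≤ f + g (2w)^{q/2}`, and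
`w'` is nondecreasing. -/
theorem IsViscositySubsolution.le_of_radiusPos_lt (hn : 1 ≤ n) (hq0 : 0 < q) (hq2 : q < 2)
    (hf : Continuous f) (hfpos : ∀ t, 0 < f t) (hfmono : StrictMono f) (hgmono : Monotone g)
    (hh : Continuous h) (hhmono : Monotone h) (hh0 : ∀ t, 0 ≤ h t) (hgh : ∀ t, a < t → g t = h t)
    (hF : IsDegenerateElliptic F) (hu : IsViscositySubsolution F f g q Ω u)
    (hball : Metric.ball x₀ d ⊆ Ω)
    (hd : ENNReal.ofReal (2 * ((n : ℝ) / (2 - q)) ^ (1 / (2 - q))) *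
      ∫⁻ t in Set.Ioi a, ENNReal.ofReal
        (1 / ((∫ s in a..t, f s) ^ (1 / 2 : ℝ) + (∫ s in a..t, h s) ^ (1 / (2 - q)))) <
      ENNReal.ofReal d) :
    u x₀ ≤ a := by
  have hn1 : (1 : ℝ) ≤ n := by exact_mod_cast hn
  have hn0 : (0 : ℝ) < n := by linarith
  have hx0 : 0 < 2 - q := by linarith
  set p : ℝ := 2 / (2 - q) with hp
  have hp1 : 0 < p - 1 := by
    have : p - 1 = q / (2 - q) := by rw [hp]; field_simp; ring
    rw [this]; positivity
  set K : ℝ → ℝ := fun t => (2 - q) / n * ∫ s in a..t, h s with hK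
  set w : ℝ → ℝ := fun t => (∫ s in a..t, f s) / n + K t ^ p / 2 with hw
  set k : ℝ → ℝ := fun t => (f t + h t * K t ^ (p - 1)) / n with hk
  have hKc : Continuous K := continuous_const.mul (continuous_integral hh a)
  have hK0 : ∀ t, a ≤ t → 0 ≤ K t := fun t ht =>
    mul_nonneg (by positivity) (integral_nonneg_of_nonneg hh0 ht)
  have hKmono : MonotoneOn K (Set.Ici a) := by
    intro s hs t ht hst
    refine mul_le_mul_of_nonneg_left ?_ (by positivity)
    have h1 := intervalIntegral.integral_add_adjacent_intervals
      (hh.intervalIntegrable (μ := volume) a s)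
      (hh.intervalIntegrable s t)
    have h2 := integral_nonneg_of_nonneg hh0 hst
    linarith
  have hkc : Continuous k :=
    (hf.add (hh.mul (hKc.rpow_const fun _ => Or.inr hp1.le))).div_const _
  have hFpos : ∀ t, a < t → 0 < ∫ s in a..t, f s := fun t ht => integral_pos_of_pos hf hfpos ht
  have hKp0 : ∀ t, a ≤ t → 0 ≤ K t ^ p := fun t ht => Real.rpow_nonneg (hK0 t ht) p
  have hk0 : ∀ t, a ≤ t → 0 ≤ k t := fun t ht =>
    div_nonneg (add_nonneg (hfpos t).le
      (mul_nonneg (hh0 t) (Real.rpow_nonneg (hK0 t ht) _))) hn0.le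
  have hwpos : ∀ t, a < t → 0 < w t := fun t ht =>
    add_pos_of_pos_of_nonneg (div_pos (hFpos t ht) hn0) (div_nonneg (hKp0 t ht.le) zero_le_two)
  have hwd : ∀ t, HasDerivAt w (k t) t := by
    intro t
    have h1 := ((hasDerivAt_integral hh a t).const_mul ((2 - q) / n)).rpow_const (p := p)
      (Or.inr (by linarith))
    have h2 := ((hasDerivAt_integral hf a t).div_const (n : ℝ)).add (h1.div_const 2)
    refine h2.congr_deriv ?_
    have h3 : (2 - q) * p = 2 := by rw [hp]; field_simp
    simp only [hk, hK]
    linear_combination h t * K t ^ (p - 1) / (2 * n) * h3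
  have hKa : K a = 0 := by simp [hK]
  have hwa : w a = 0 := by
    simp only [hw, hKa, intervalIntegral.integral_same, zero_div, zero_add]
    rw [Real.zero_rpow (by linarith), zero_div]
  have hF2w : ∀ t, a < t → (∫ s in a..t, f s) / (n / 2) ≤ 2 * w t := fun t ht => by
    have := hKp0 t ht.le
    simp only [hw]
    rw [div_div_eq_mul_div, mul_add, mul_div_cancel₀ _ two_ne_zero, mul_div_assoc', mul_comm 2]
    linarith
  have hK2w : ∀ t, a < t → K t ^ p ≤ 2 * w t := fun t ht => by
    have := div_pos (hFpos t ht) hn0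
    simp only [hw]
    linarith
  refine hu.le_of_barrier hn hq0 hfmono hgmono (w := w) (w' := k) (k := k)
    (fun t _ => hwd t) hkc.continuousOn hwpos ?_ ?_ hkc.continuousWithinAt (hk0 a le_rfl) ?_
    (fun t _ => le_rfl) ?_ hF hball
    (lintegral_lt_of_le_const_mul (C := 2 * ((n : ℝ) / (2 - q)) ^ (1 / (2 - q)))
      (by positivity) ?_ hd)
  · have := (hwd a).continuousAt.tendsto
    rw [hwa] at this
    exact this.mono_left nhdsWithin_le_nhds
  · intro s hs t ht hst
    refine div_le_div_of_nonneg_right (add_le_add (hfmono.monotone hst) ?_) hn0.le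
    exact mul_le_mul (hhmono hst) (Real.rpow_le_rpow (hK0 s hs) (hKmono hs ht hst) hp1.le)
      (Real.rpow_nonneg (hK0 s hs) _) (hh0 t)
  · simp only [hk, hKa]
    rw [Real.zero_rpow hp1.ne', mul_zero, add_zero, mul_div_cancel₀ _ hn0.ne']
  · intro t ht
    have h1 : K t ^ (p - 1) ≤ (2 * w t) ^ (q / 2) := by
      have h2 : K t ^ (p - 1) = (K t ^ p) ^ (q / 2) := by
        rw [← Real.rpow_mul (hK0 t ht.le)]
        congr 1
        rw [hp]
        field_simp
        ring
      rw [h2]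
      exact Real.rpow_le_rpow (hKp0 t ht.le) (hK2w t ht) (by positivity)
    have h3 := mul_le_mul_of_nonneg_left h1 (hh0 t)
    have h4 : (n : ℝ) * k t = f t + h t * K t ^ (p - 1) := mul_div_cancel₀ _ hn0.ne'
    rw [max_eq_left (hk0 t ht.le), hgh t ht]
    linarith
  · intro t ht
    have h2w : 0 < 2 * w t := mul_pos two_pos (hwpos t ht)
    set A := (∫ s in a..t, f s) ^ (1 / 2 : ℝ) with hA
    set B := (∫ s in a..t, h s) ^ (1 / (2 - q)) with hB
    set c := ((n : ℝ) / (2 - q)) ^ (1 / (2 - q)) with hc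
    have hc0 : 0 < c := by positivity
    have hA0 : 0 < A := Real.rpow_pos_of_pos (hFpos t ht) _
    have hG0 : 0 ≤ ∫ s in a..t, h s := integral_nonneg_of_nonneg hh0 ht.le
    have hB0 : 0 ≤ B := Real.rpow_nonneg hG0 _
    have hs : 0 < Real.sqrt (2 * w t) := Real.sqrt_pos.2 h2w
    have hAle : A ≤ c * Real.sqrt (2 * w t) := by
      have h1 : A ≤ (n / 2 * (2 * w t)) ^ (1 / 2 : ℝ) := by
        refine Real.rpow_le_rpow (hFpos t ht).le ?_ (by norm_num)
        have := hF2w t ht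
        rwa [div_le_iff₀' (by positivity)] at this
      rw [Real.mul_rpow (by positivity) h2w.le, ← Real.sqrt_eq_rpow (2 * w t)] at h1
      exact h1.trans (mul_le_mul_of_nonneg_right (sqrt_half_le hn1 hx0 (by linarith)) hs.le)
    have hBle : B ≤ c * Real.sqrt (2 * w t) := by
      have h1 : ∫ s in a..t, h s = n / (2 - q) * K t := by
        simp only [hK]
        field_simp
      rw [hB, h1, Real.mul_rpow (by positivity) (hK0 t ht.le)]
      refine mul_le_mul_of_nonneg_left (Real.le_sqrt_of_sq_le ?_) hc0.le
      rw [← Real.rpow_natCast, ← Real.rpow_mul (hK0 t ht.le)]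
      have h2 : 1 / (2 - q) * ((2 : ℕ) : ℝ) = p := by rw [hp]; push_cast; ring
      rw [h2]
      exact hK2w t ht
    rw [mul_one_div, div_le_div_iff₀ hs (by linarith)]
    linarith

/-- For `g ≥ 0` and `q = 2` the equation `n w' = f + 2 g w` is linear. -/
theorem IsViscositySubsolution.le_of_radiusPos_two_lt (hn : 1 ≤ n)
    (hf : Continuous f) (hfpos : ∀ t, 0 < f t) (hfmono : StrictMono f) (hgmono : Monotone g)
    (hh : Continuous h) (hhmono : Monotone h) (hh0 : ∀ t, 0 ≤ h t) (hgh : ∀ t, a < t → g t = h t)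
    (hF : IsDegenerateElliptic F) (hu : IsViscositySubsolution F f g 2 Ω u)
    (hball : Metric.ball x₀ d ⊆ Ω)
    (hd : ENNReal.ofReal (Real.sqrt ((n : ℝ) / 2)) * ∫⁻ t in Set.Ioi a, ENNReal.ofReal
        (1 / linearSolution (fun r => 2 / n * h r) f a t ^ (1 / 2 : ℝ)) < ENNReal.ofReal d) :
    u x₀ ≤ a := by
  have hn1 : (1 : ℝ) ≤ n := by exact_mod_cast hn
  have hn0 : (0 : ℝ) < n := by linarith
  have hκ : Continuous fun r => 2 / n * h r := continuous_const.mul hh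
  set D := linearSolution (fun r => 2 / n * h r) f a with hD
  have hDd : ∀ t, HasDerivAt D (f t + 2 / n * h t * D t) t := hasDerivAt_linearSolution hκ hf a
  have hDpos : ∀ t, a < t → 0 < D t := fun t ht => linearSolution_pos hκ hf hfpos ht
  have hDa : D a = 0 := linearSolution_self _ _ _
  have hD0 : ∀ t, a ≤ t → 0 ≤ D t := fun t ht => by
    rcases ht.eq_or_lt with rfl | h
    · exact hDa.ge
    · exact (hDpos t h).le
  have hDc : Continuous D := continuous_linearSolution hκ hf a
  set k : ℝ → ℝ := fun t => (f t + 2 / n * h t * D t) / n with hk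
  have hkc : Continuous k := by simp only [hk]; fun_prop
  have hk0 : ∀ t, a ≤ t → 0 ≤ k t := fun t ht => by
    have := hD0 t ht; have := hh0 t; have := hfpos t
    simp only [hk]; positivity
  have hDmono : MonotoneOn D (Set.Ici a) := by
    refine monotoneOn_of_hasDerivWithinAt_nonneg (convex_Ici a) hDc.continuousOn
      (fun t _ => (hDd t).hasDerivWithinAt) fun t ht => ?_
    rw [interior_Ici] at ht
    have := hDpos t ht; have := hh0 t; have := hfpos t
    positivity
  refine hu.le_of_barrier hn two_pos hfmono hgmono (w := fun t => D t / n) (w' := k) (k := k)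
    (fun t _ => (hDd t).div_const _) hkc.continuousOn (fun t ht => div_pos (hDpos t ht) hn0) ?_ ?_
    hkc.continuousWithinAt (hk0 a le_rfl) ?_ (fun t _ => le_rfl) ?_ hF hball
    (lintegral_lt_of_le_const_mul (Real.sqrt_nonneg _) ?_ hd)
  · have := ((hDc.div_const (n : ℝ)).tendsto a)
    simp only [hDa, zero_div] at this
    exact this.mono_left nhdsWithin_le_nhds
  · intro s hs t ht hst
    have h1 : 2 / n * h s * D s ≤ 2 / n * h t * D t :=
      mul_le_mul (mul_le_mul_of_nonneg_left (hhmono hst) (by positivity)) (hDmono hs ht hst)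
        (hD0 s hs) (mul_nonneg (by positivity) (hh0 t))
    exact div_le_div_of_nonneg_right (add_le_add (hfmono.monotone hst) h1) hn0.le
  · simp only [hk, hDa]
    rw [mul_zero, add_zero, mul_div_cancel₀ _ hn0.ne']
  · intro t ht
    rw [max_eq_left (hk0 t ht.le), hgh t ht, div_self two_ne_zero, Real.rpow_one]
    have h4 : (n : ℝ) * k t = f t + 2 / n * h t * D t := mul_div_cancel₀ _ hn0.ne'
    have h5 : h t * (2 * (D t / n)) = 2 / n * h t * D t := by ring
    linarith
  · intro t ht
    have hDt := hDpos t ht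
    refine one_div_sqrt_le (by positivity) (le_of_eq ?_)
    rw [mul_pow, Real.sq_sqrt (by positivity), div_pow, ← Real.sqrt_eq_rpow,
      Real.sq_sqrt hDt.le]
    field_simp

/-- Along the solution of `ψ' = f - 2 m f ψ` with `m ≥ 0` nonincreasing, `2 m ψ ≤ 1`: the solution
does not overtake the increasing equilibrium `1/(2m)`. -/
theorem two_mul_mul_linearSolution_le_one {m : ℝ → ℝ} (hm : Continuous m)
    (hf : Continuous f) (hfpos : ∀ t, 0 < f t) (hmanti : Antitone m) {t : ℝ} (hat : a ≤ t) :
    2 * m t * linearSolution (fun r => -2 * (m r * f r)) f a t ≤ 1 := by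
  have hκ : Continuous fun r => -2 * (m r * f r) := by fun_prop
  have hc := continuous_integrand_linearSolution hκ hf t
  have hder : ∀ s, HasDerivAt (fun s => Real.exp (∫ r in s..t, -2 * (m r * f r)))
      (Real.exp (∫ r in s..t, -2 * (m r * f r)) * (2 * (m s * f s))) s := by
    intro s
    have h1 : (fun s => ∫ r in s..t, -2 * (m r * f r)) = fun s => -∫ r in t..s, -2 * (m r * f r) :=
      funext fun s => intervalIntegral.integral_symm _ _
    have h2 : HasDerivAt (fun s => ∫ r in s..t, -2 * (m r * f r)) (2 * (m s * f s)) s := by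
      rw [h1]
      exact (hasDerivAt_integral hκ t s).neg.congr_deriv (by ring)
    exact h2.exp
  have hcc : Continuous fun s => Real.exp (∫ r in s..t, -2 * (m r * f r)) * (2 * (m s * f s)) := by
    have : Continuous fun s => Real.exp (∫ r in s..t, -2 * (m r * f r)) :=
      continuous_iff_continuousAt.2 fun s => (hder s).continuousAt
    fun_prop
  have hint := intervalIntegral.integral_eq_sub_of_hasDerivAt (a := a) (b := t)
    (fun s _ => hder s) (hcc.intervalIntegrable _ _)
  rw [intervalIntegral.integral_same, Real.exp_zero] at hint
  have hle : 2 * m t * linearSolution (fun r => -2 * (m r * f r)) f a t ≤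
      ∫ s in a..t, Real.exp (∫ r in s..t, -2 * (m r * f r)) * (2 * (m s * f s)) := by
    rw [linearSolution, ← intervalIntegral.integral_const_mul]
    refine intervalIntegral.integral_mono_on hat ((hc.const_mul _).intervalIntegrable _ _)
      (hcc.intervalIntegrable _ _) fun s hs => ?_
    have h1 := mul_le_mul_of_nonneg_right (hmanti hs.2)
      (mul_pos (Real.exp_pos (∫ r in s..t, -2 * (m r * f r))) (hfpos s)).le
    linarith
  have := Real.exp_pos (∫ r in a..t, -2 * (m r * f r))
  linarith

/-- For `g = -h ≤ 0` the choice `w = (q/2) n^{-2/q} ψ` with `ψ' = f - 2 (h/f)^{2/q} f ψ` satisfies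
`0 ≤ w' ≤ f/n - h (2w)^{q/2}`; the power `(2w)^{q/2}` is estimated by its tangent line. -/
theorem IsViscositySubsolution.le_of_radiusZero_lt (hn : 1 ≤ n) (hq0 : 0 < q) (hq2 : q ≤ 2)
    (hf : Continuous f) (hfpos : ∀ t, 0 < f t) (hfmono : StrictMono f) (hgmono : Monotone g)
    (hh : Continuous h) (hhanti : Antitone h) (hh0 : ∀ t, 0 ≤ h t) (hgh : ∀ t, g t = -h t)
    (hF : IsDegenerateElliptic F) (hu : IsViscositySubsolution F f g q Ω u)
    (hball : Metric.ball x₀ d ⊆ Ω)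
    (hd : ENNReal.ofReal ((n : ℝ) ^ (1 / q) / Real.sqrt q) * ∫⁻ t in Set.Ioi a, ENNReal.ofReal
        (1 / linearSolution (fun r => -2 * ((h r / f r) ^ (2 / q) * f r)) f a t ^ (1 / 2 : ℝ)) <
      ENNReal.ofReal d) :
    u x₀ ≤ a := by
  have hn1 : (1 : ℝ) ≤ n := by exact_mod_cast hn
  have hn0 : (0 : ℝ) < n := by linarith
  set m : ℝ → ℝ := fun r => (h r / f r) ^ (2 / q) with hm
  have hhf0 : ∀ t, 0 ≤ h t / f t := fun t => div_nonneg (hh0 t) (hfpos t).le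
  have hm0 : ∀ t, 0 ≤ m t := fun t => Real.rpow_nonneg (hhf0 t) _
  have hmc : Continuous m :=
    (hh.div hf fun t => (hfpos t).ne').rpow_const fun _ => Or.inr (by positivity)
  have hmanti : Antitone m := fun s t hst => Real.rpow_le_rpow (hhf0 t)
    (div_le_div₀ (hh0 s) (hhanti hst) (hfpos s) (hfmono.monotone hst)) (by positivity)
  have hκ : Continuous fun r => -2 * (m r * f r) := by fun_prop
  set ψ := linearSolution (fun r => -2 * (m r * f r)) f a with hψ
  have hψd : ∀ t, HasDerivAt ψ (f t + -2 * (m t * f t) * ψ t) t :=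
    hasDerivAt_linearSolution hκ hf a
  have hψpos : ∀ t, a < t → 0 < ψ t := fun t ht => linearSolution_pos hκ hf hfpos ht
  have hψc : Continuous ψ := continuous_linearSolution hκ hf a
  have hψa : ψ a = 0 := linearSolution_self _ _ _
  set c : ℝ := (n : ℝ) ^ (-(2 / q)) with hc
  have hc0 : 0 < c := Real.rpow_pos_of_pos hn0 _
  have hcn : n * c ≤ 1 := by
    have h1 : (n : ℝ) * c = (n : ℝ) ^ (1 - 2 / q) := by
      rw [hc, sub_eq_add_neg, Real.rpow_add hn0, Real.rpow_one]
    rw [h1]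
    refine Real.rpow_le_one_of_one_le_of_nonpos hn1 ?_
    rw [sub_nonpos, le_div_iff₀ hq0]
    linarith
  have hcq : c ^ (q / 2) = 1 / n := by
    rw [hc, ← Real.rpow_mul hn0.le, show -(2 / q) * (q / 2) = -1 by field_simp, Real.rpow_neg_one,
      one_div]
  set w : ℝ → ℝ := fun t => q / 2 * c * ψ t with hw
  set w' : ℝ → ℝ := fun t => q / 2 * c * (f t + -2 * (m t * f t) * ψ t) with hw'
  have hkey : ∀ t, a < t → 0 ≤ w' t ∧ w' t ≤ f t / n - h t * (2 * w t) ^ (q / 2) := by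
    intro t ht
    set z := m t * ψ t with hz
    have hz0 : 0 ≤ z := mul_nonneg (hm0 t) (hψpos t ht).le
    have hz1 : 2 * z ≤ 1 := by
      have := two_mul_mul_linearSolution_le_one hmc hf hfpos hmanti ht.le
      rw [hz]
      linarith
    have hw'z : w' t = f t * (q / 2 * c * (1 - 2 * z)) := by simp only [hw', hz]; ring
    have hft := hfpos t
    have hpow : h t * (2 * w t) ^ (q / 2) = f t * (1 / n * (q * z) ^ (q / 2)) := by
      have h1 : h t = f t * m t ^ (q / 2) := by
        rw [hm]
        simp only
        rw [← Real.rpow_mul (hhf0 t), show 2 / q * (q / 2) = 1 by field_simp, Real.rpow_one]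
        field_simp
      have h2 : 2 * w t = c * (q * ψ t) := by simp only [hw]; ring
      rw [h1, h2, mul_assoc, Real.mul_rpow hc0.le (by have := hψpos t ht; positivity), hcq,
        mul_left_comm (m t ^ (q / 2)), ← Real.mul_rpow (hm0 t) (by have := hψpos t ht; positivity)]
      rw [show m t * (q * ψ t) = q * z by rw [hz]; ring]
    refine ⟨?_, ?_⟩
    · rw [hw'z]
      have : 0 ≤ 1 - 2 * z := by linarith
      positivity
    · rw [hw'z, hpow, div_eq_mul_one_div (f t), ← mul_sub]
      refine mul_le_mul_of_nonneg_left ?_ hft.le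
      have hb := rpow_le_one_add_mul_sub (show 0 ≤ q * z by positivity)
        (show 0 ≤ q / 2 by positivity) (by linarith)
      have hcn' : c ≤ 1 / n := by rw [le_div_iff₀ hn0]; linarith
      have h1 : q / 2 * c * (1 - 2 * z) ≤ 1 / n * (q / 2 * (1 - 2 * z)) := by
        have := mul_le_mul_of_nonneg_right hcn' (show 0 ≤ q / 2 * (1 - 2 * z) by
          have : 0 ≤ 1 - 2 * z := by linarith
          positivity)
        linarith
      have h2 : q / 2 * (1 - 2 * z) ≤ 1 - (q * z) ^ (q / 2) := by
        nlinarith [mul_nonneg (mul_nonneg hq0.le hz0) (show 0 ≤ 2 - q by linarith)]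
      have h3 := mul_le_mul_of_nonneg_left h2 (show 0 ≤ 1 / (n : ℝ) by positivity)
      linarith
  refine hu.le_of_barrier hn hq0 hfmono hgmono (w := w) (w' := w') (k := fun t => f t / n)
    (fun t _ => (hψd t).const_mul _) (by simp only [hw']; fun_prop)
    (fun t ht => by have := hψpos t ht; simp only [hw]; positivity) ?_
    (fun s _ t _ hst => div_le_div_of_nonneg_right (hfmono.monotone hst) hn0.le)
    (hf.div_const _).continuousWithinAt (div_pos (hfpos a) hn0).le
    (mul_div_cancel₀ _ hn0.ne').le (fun t ht => ?_) (fun t ht => ?_) hF hball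
    (lintegral_lt_of_le_const_mul (by positivity) (fun t ht => ?_) hd)
  · have := ((hψc.const_mul (q / 2 * c)).tendsto a)
    rw [hψa, mul_zero] at this
    exact this.mono_left nhdsWithin_le_nhds
  · have h1 := mul_nonneg (hh0 t) (Real.rpow_nonneg (show 0 ≤ 2 * w t by
      have := hψpos t ht; simp only [hw]; positivity) (q / 2))
    linarith [(hkey t ht).2]
  · rw [max_eq_left (hkey t ht).1, hgh]
    have h1 : (n : ℝ) * (f t / n) = f t := mul_div_cancel₀ _ hn0.ne'
    linarith [(hkey t ht).2]
  · have hψt := hψpos t ht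
    refine one_div_sqrt_le (by positivity) (le_of_eq ?_)
    have h1 : ((n : ℝ) ^ (1 / q)) ^ 2 * c = 1 := by
      rw [hc, ← Real.rpow_natCast, ← Real.rpow_mul hn0.le, ← Real.rpow_add hn0]
      rw [show 1 / q * ((2 : ℕ) : ℝ) + -(2 / q) = 0 by push_cast; ring, Real.rpow_zero]
    rw [mul_pow, div_pow, div_pow, Real.sq_sqrt hq0.le, ← Real.sqrt_eq_rpow, Real.sq_sqrt hψt.le]
    have h2 : 2 * w t = q * c * ψ t := by simp only [hw]; ring
    rw [h2, one_pow, div_mul_div_comm, mul_one, div_eq_div_iff (by positivity) (by positivity)]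
    linear_combination (-(q * ψ t)) * h1

/-- The algebraic inequality behind the barrier for `g < 0`, with `ρ = q/2`. It is affine in `y`
once `(ρ² σ)^ρ` is replaced by its tangent line. -/
theorem barrier_polynomial_le {ρ σ y : ℝ} (hρ0 : 0 < ρ) (hρ1 : ρ ≤ 1) (hσ0 : 0 ≤ σ) (hσ1 : σ ≤ 1)
    (hy0 : 0 ≤ y) (hy1 : y ≤ 1) :
    ρ ^ 2 / 2 * ((1 - σ) * (1 - σ + σ * (1 - y) / ρ)) + y * (ρ ^ 2 * σ) ^ ρ ≤ 1 := by
  have hb := rpow_le_one_add_mul_sub (show 0 ≤ ρ ^ 2 * σ by positivity) hρ0.le hρ1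
  have h0 : ρ ^ 2 / 2 * ((1 - σ) * (1 - σ + σ * (1 - y) / ρ)) =
      ρ ^ 2 / 2 * (1 - σ) ^ 2 + ρ / 2 * (σ * (1 - σ)) * (1 - y) := by
    field_simp
  have hρ2 : ρ ^ 2 ≤ ρ := by nlinarith
  have hs2 : (1 - σ) ^ 2 ≤ 1 - σ := by nlinarith
  -- The values of the affine bound at `y = 0` and at `y = 1` are both at most `1`.
  have e0 : ρ ^ 2 / 2 * (1 - σ) ^ 2 + ρ / 2 * (σ * (1 - σ)) ≤ 1 := by
    have h1 : ρ ^ 2 / 2 * (1 - σ) ^ 2 ≤ 1 / 2 * 1 :=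
      mul_le_mul (by linarith) (by linarith) (sq_nonneg _) (by norm_num)
    have h2 : ρ / 2 * (σ * (1 - σ)) ≤ 1 / 2 * 1 :=
      mul_le_mul (by linarith) (by nlinarith) (mul_nonneg hσ0 (by linarith)) (by norm_num)
    linarith
  have e1 : ρ ^ 2 / 2 * (1 - σ) ^ 2 + (1 + ρ * (ρ ^ 2 * σ - 1)) ≤ 1 := by
    have h1 : ρ / 2 * (1 - σ) ^ 2 + ρ ^ 2 * σ ≤ 1 := by
      have h2 : ρ / 2 * (1 - σ) ^ 2 ≤ 1 * (1 - σ) :=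
        mul_le_mul (by linarith) hs2 (sq_nonneg _) zero_le_one
      have h3 : ρ ^ 2 * σ ≤ 1 * σ := mul_le_mul_of_nonneg_right (by linarith) hσ0
      linarith
    have := mul_le_mul_of_nonneg_left h1 hρ0.le
    nlinarith
  have h2 := mul_le_mul_of_nonneg_left hb hy0
  have h3 := mul_le_mul_of_nonneg_left e0 (show 0 ≤ 1 - y by linarith)
  have h4 := mul_le_mul_of_nonneg_left e1 hy0
  rw [h0]
  linarith

/-- For `g = -h < 0`, with `Φ = ∫_a^t f` and `H = ∫_a^t h`, the choice
`2 w = c² Φ / (1 + S)`, `S = (H/Φ)^{2/q} Φ`, `c = q/(2 n^{1/q})`, satisfies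
`0 ≤ w' ≤ f/n - h (2w)^{q/2}`. Here `1/(2w) = c⁻² (1/Φ + (H/Φ)^{2/q})`. -/
theorem IsViscositySubsolution.le_of_radiusNeg_lt (hn : 1 ≤ n) (hq0 : 0 < q) (hq2 : q ≤ 2)
    (hf : Continuous f) (hfpos : ∀ t, 0 < f t) (hfmono : StrictMono f) (hgmono : Monotone g)
    (hh : Continuous h) (hhanti : Antitone h) (hh0 : ∀ t, 0 < h t) (hgh : ∀ t, g t = -h t)
    (hF : IsDegenerateElliptic F) (hu : IsViscositySubsolution F f g q Ω u)
    (hball : Metric.ball x₀ d ⊆ Ω)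
    (hd : ENNReal.ofReal (2 * ((n : ℝ) ^ (1 / q) / q)) * ∫⁻ t in Set.Ioi a, ENNReal.ofReal
        (1 / (∫ s in a..t, f s) ^ (1 / 2 : ℝ) +
          ((∫ s in a..t, h s) / (∫ s in a..t, f s)) ^ (1 / q)) < ENNReal.ofReal d) :
    u x₀ ≤ a := by
  have hn1 : (1 : ℝ) ≤ n := by exact_mod_cast hn
  have hn0 : (0 : ℝ) < n := by linarith
  set Φ : ℝ → ℝ := fun t => ∫ s in a..t, f s with hΦ
  set H : ℝ → ℝ := fun t => ∫ s in a..t, h s with hH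
  have hΦd : ∀ t, HasDerivAt Φ (f t) t := hasDerivAt_integral hf a
  have hHd : ∀ t, HasDerivAt H (h t) t := hasDerivAt_integral hh a
  have hΦpos : ∀ t, a < t → 0 < Φ t := fun t ht => integral_pos_of_pos hf hfpos ht
  have hHpos : ∀ t, a < t → 0 < H t := fun t ht => integral_pos_of_pos hh hh0 ht
  have hΦc : Continuous Φ := continuous_integral hf a
  have hHc : Continuous H := continuous_integral hh a
  set S : ℝ → ℝ := fun t => (H t / Φ t) ^ (2 / q) * Φ t with hS
  have hSpos : ∀ t, a < t → 0 < S t := fun t ht =>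
    mul_pos (Real.rpow_pos_of_pos (div_pos (hHpos t ht) (hΦpos t ht)) _) (hΦpos t ht)
  set y : ℝ → ℝ := fun t => h t * Φ t / (H t * f t) with hy
  have hy0 : ∀ t, a < t → 0 ≤ y t := fun t ht => by
    have := hh0 t; have := hfpos t; have := hΦpos t ht; have := hHpos t ht
    simp only [hy]; positivity
  have hy1 : ∀ t, a < t → y t ≤ 1 := fun t ht => by
    have h1 := integral_le_mul_of_monotone hf hfmono.monotone ht.le
    have h2 := mul_le_integral_of_antitone hh hhanti ht.le
    have h3 := mul_le_mul_of_nonneg_left h1 (hh0 t).le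
    have h4 := mul_le_mul_of_nonneg_right h2 (hfpos t).le
    refine (div_le_one (mul_pos (hHpos t ht) (hfpos t))).2 ?_
    simp only [hΦ, hH]
    linarith
  set c : ℝ := q / (2 * (n : ℝ) ^ (1 / q)) with hc
  have hnq : 0 < (n : ℝ) ^ (1 / q) := Real.rpow_pos_of_pos hn0 _
  have hc0 : 0 < c := by positivity
  have hcq : c ^ q = (q / 2) ^ q / n := by
    rw [hc, ← div_div, Real.div_rpow (by positivity) hnq.le, ← Real.rpow_mul hn0.le,
      one_div_mul_cancel hq0.ne', Real.rpow_one]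
  have hnc : n * c ^ 2 ≤ (q / 2) ^ 2 := by
    have h1 : (n : ℝ) ≤ ((n : ℝ) ^ (1 / q)) ^ 2 := by
      rw [← Real.rpow_natCast, ← Real.rpow_mul hn0.le]
      refine Real.self_le_rpow_of_one_le hn1 ?_
      rw [div_mul_eq_mul_div, le_div_iff₀ hq0]
      push_cast
      linarith
    rw [hc, ← div_div, div_pow, mul_div_assoc', div_le_iff₀ (by positivity), mul_comm]
    exact mul_le_mul_of_nonneg_left h1 (by positivity)
  set w : ℝ → ℝ := fun t => c ^ 2 / 2 * (Φ t / (1 + S t)) with hw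
  set w' : ℝ → ℝ := fun t => c ^ 2 / 2 * (f t * (1 + S t * (2 / q) * (1 - y t)) / (1 + S t) ^ 2)
    with hw'
  have hwpos : ∀ t, a < t → 0 < w t := fun t ht => by
    have := hΦpos t ht; have := hSpos t ht
    simp only [hw]; positivity
  have hwd : ∀ t, a < t → HasDerivAt w (w' t) t := by
    intro t ht
    have hΦt := hΦpos t ht
    have hHt := hHpos t ht
    have hSt := hSpos t ht
    have hft := hfpos t
    have h1 := ((hHd t).div (hΦd t) hΦt.ne').rpow_const (p := 2 / q)
      (Or.inl (div_pos hHt hΦt).ne')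
    have h2 := (h1.mul (hΦd t)).const_add 1
    have h3 := ((hΦd t).div h2 (by
      change (1 + S t) ≠ 0
      positivity)).const_mul (c ^ 2 / 2)
    refine h3.congr_deriv ?_
    have hpow : (H t / Φ t) ^ (2 / q - 1) = (H t / Φ t) ^ (2 / q) / (H t / Φ t) :=
      Real.rpow_sub_one (div_pos hHt hΦt).ne' _
    simp only [hw', hy, Pi.div_apply, Pi.mul_apply, hpow]
    have hSe : (H t / Φ t) ^ (2 / q) = S t / Φ t := by
      simp only [hS]; field_simp
    rw [hSe, div_mul_cancel₀ _ hΦt.ne']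
    field_simp
    ring
  have hkey : ∀ t, a < t → 0 ≤ w' t ∧ w' t ≤ f t / n - h t * (2 * w t) ^ (q / 2) := by
    intro t ht
    have hΦt := hΦpos t ht
    have hHt := hHpos t ht
    have hSt := hSpos t ht
    have hft := hfpos t
    have hyt0 := hy0 t ht
    have hyt1 : 0 ≤ 1 - y t := by linarith [hy1 t ht]
    refine ⟨by simp only [hw']; positivity, ?_⟩
    set σ := S t / (1 + S t) with hσ
    have hσ0 : 0 ≤ σ := by positivity
    have hσ1 : σ ≤ 1 := (div_le_one (by linarith)).2 (by linarith)
    set ρ := q / 2 with hρ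
    have hρ0 : 0 < ρ := by positivity
    have hpoly := barrier_polynomial_le hρ0 (by linarith) hσ0 hσ1 hyt0 (hy1 t ht)
    set B := (1 - σ) * (1 - σ + σ * (1 - y t) / ρ) with hB
    have hB0 : 0 ≤ B := by
      have : 0 ≤ 1 - σ := by linarith
      positivity
    have hw'B : w' t = f t * (c ^ 2 / 2 * B) := by
      have h1 : 1 - σ = 1 / (1 + S t) := by rw [hσ]; field_simp; ring
      rw [hB, h1, hσ, hρ]
      simp only [hw']
      field_simp
    have hpow : h t * (2 * w t) ^ ρ = f t * (1 / n * (y t * (ρ ^ 2 * σ) ^ ρ)) := by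
      have h1 : 2 * w t = c ^ 2 * (Φ t / (1 + S t)) := by simp only [hw]; ring
      have h2 : ∀ x : ℝ, 0 ≤ x → (x ^ 2) ^ ρ = x ^ q := fun x hx => by
        rw [← Real.rpow_natCast, ← Real.rpow_mul hx]
        congr 1
        rw [hρ]; push_cast; ring
      have h3 : σ = (H t / Φ t) ^ (2 / q) * (Φ t / (1 + S t)) := by
        rw [hσ]; simp only [hS]; ring
      have h4 : ((H t / Φ t) ^ (2 / q)) ^ ρ = H t / Φ t := by
        rw [← Real.rpow_mul (by positivity), hρ, show 2 / q * (q / 2) = 1 by field_simp,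
          Real.rpow_one]
      rw [h1, Real.mul_rpow (by positivity) (by positivity), h2 c hc0.le, hcq,
        Real.mul_rpow (by positivity) hσ0, h2 ρ hρ0.le, h3,
        Real.mul_rpow (by positivity) (by positivity), h4]
      simp only [hy]
      field_simp
    rw [hw'B, hpow, div_eq_mul_one_div (f t), ← mul_sub]
    refine mul_le_mul_of_nonneg_left ?_ hft.le
    rw [le_sub_iff_add_le, le_div_iff₀ hn0]
    have h5 := mul_le_mul_of_nonneg_right hnc (show 0 ≤ B / 2 by positivity)
    have h6 : 1 / (n : ℝ) * (y t * (ρ ^ 2 * σ) ^ ρ) * n = y t * (ρ ^ 2 * σ) ^ ρ := by field_simp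
    rw [add_mul, h6]
    linarith
  refine hu.le_of_barrier hn hq0 hfmono hgmono (w := w) (w' := w') (k := fun t => f t / n)
    hwd ?_ hwpos ?_
    (fun s _ t _ hst => div_le_div_of_nonneg_right (hfmono.monotone hst) hn0.le)
    (hf.div_const _).continuousWithinAt (div_pos (hfpos a) hn0).le
    (mul_div_cancel₀ _ hn0.ne').le (fun t ht => ?_) (fun t ht => ?_) hF hball
    (lintegral_lt_of_le_const_mul (by positivity) (fun t ht => ?_) hd)
  · have hSc : ContinuousOn S (Set.Ioi a) :=
      ((hHc.continuousOn.div hΦc.continuousOn fun t ht => (hΦpos t ht).ne').rpow_const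
        fun t ht => Or.inr (by positivity)).mul hΦc.continuousOn
    have hyc : ContinuousOn y (Set.Ioi a) := (hh.mul hΦc).continuousOn.div
      (hHc.mul hf).continuousOn fun t ht => (mul_pos (hHpos t ht) (hfpos t)).ne'
    refine continuousOn_const.mul (ContinuousOn.div (by fun_prop) (by fun_prop) fun t ht => ?_)
    have := hSpos t ht
    positivity
  · have h1 : Tendsto (fun t => c ^ 2 / 2 * Φ t) (𝓝[>] a) (𝓝 0) := by
      have := (hΦc.const_mul (c ^ 2 / 2)).tendsto a
      have hΦa : Φ a = 0 := intervalIntegral.integral_same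
      rw [hΦa, mul_zero] at this
      exact this.mono_left nhdsWithin_le_nhds
    refine tendsto_of_tendsto_of_tendsto_of_le_of_le' tendsto_const_nhds h1 ?_ ?_
    · filter_upwards [self_mem_nhdsWithin] with t ht using (hwpos t ht).le
    · filter_upwards [self_mem_nhdsWithin] with t ht
      have := hSpos t ht
      exact mul_le_mul_of_nonneg_left (div_le_self (hΦpos t ht).le (by linarith)) (by positivity)
  · have h1 := mul_nonneg (hh0 t).le (Real.rpow_nonneg (mul_pos two_pos (hwpos t ht)).le (q / 2))
    linarith [(hkey t ht).2]
  · rw [max_eq_left (hkey t ht).1, hgh]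
    have h1 : (n : ℝ) * (f t / n) = f t := mul_div_cancel₀ _ hn0.ne'
    linarith [(hkey t ht).2]
  · have hΦt := hΦpos t ht
    have hHt := hHpos t ht
    have hSt := hSpos t ht
    have hQ : 0 < H t / Φ t := div_pos hHt hΦt
    refine one_div_sqrt_le (by positivity) ?_
    have h1 : 1 / (2 * w t) = (1 / c) ^ 2 * (1 / Φ t + (H t / Φ t) ^ (2 / q)) := by
      simp only [hw]
      have : (H t / Φ t) ^ (2 / q) = S t / Φ t := by simp only [hS]; field_simp
      rw [this]
      field_simp
    have h2 : 2 * ((n : ℝ) ^ (1 / q) / q) = 1 / c := by rw [hc]; field_simp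
    have h3 : (H t / Φ t) ^ (2 / q) = ((H t / Φ t) ^ (1 / q)) ^ 2 := by
      rw [← Real.rpow_natCast, ← Real.rpow_mul hQ.le]
      congr 1
      push_cast
      ring
    have h4 : 1 / Φ t = (1 / Φ t ^ (1 / 2 : ℝ)) ^ 2 := by
      rw [div_pow, one_pow, ← Real.sqrt_eq_rpow, Real.sq_sqrt hΦt.le]
    rw [h1, h2, mul_pow, h3]
    refine mul_le_mul_of_nonneg_left ?_ (by positivity)
    rw [h4]
    have h5 : 0 ≤ 1 / Φ t ^ (1 / 2 : ℝ) := by positivity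
    have h6 : 0 ≤ (H t / Φ t) ^ (1 / q) := by positivity
    nlinarith [mul_nonneg h5 h6]

end Barriers

/-! ### The three radius functions -/

section Radius

variable {f h κ : ℝ → ℝ} {q : ℝ} {R : ℝ → ℝ≥0∞} {C : ℝ≥0∞}

theorem tendsto_one_div_rpow {D : ℝ → ℝ} {p : ℝ} (hp : 0 < p) (hD : Tendsto D atTop atTop) :
    Tendsto (fun a => 1 / D a ^ p) atTop (𝓝 0) := by
  simp only [one_div]
  exact ((tendsto_rpow_atTop hp).comp hD).inv_tendsto_atTop

theorem tendsto_integral_shift (hf : Continuous f) (hmono : Monotone f)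
    (hlim : Tendsto f atTop atTop) {τ : ℝ} (hτ : 0 < τ) :
    Tendsto (fun a => ∫ s in a..a + τ, f s) atTop atTop := by
  refine tendsto_atTop_mono (fun a => ?_) (hlim.const_mul_atTop hτ)
  have := mul_le_integral_of_monotone hf hmono (show a ≤ a + τ by linarith)
  rwa [add_sub_cancel_left] at this

theorem continuousOn_one_div_linearSolution (hκ : Continuous κ) (hf : Continuous f)
    (hfpos : ∀ t, 0 < f t) (a : ℝ) :
    ContinuousOn (fun t => 1 / linearSolution κ f a t ^ (1 / 2 : ℝ)) (Set.Ioi a) :=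
  continuousOn_const.div ((continuous_linearSolution hκ hf a).rpow_const
    fun _ => Or.inr (by norm_num)).continuousOn
    fun _ ht => (Real.rpow_pos_of_pos (linearSolution_pos hκ hf hfpos ht) _).ne'

theorem isDecreasingToZero_linearSolution (hC0 : C ≠ 0) (hCtop : C ≠ ⊤) (hκ : Continuous κ)
    (hκmono : Monotone κ) (hf : Continuous f) (hfpos : ∀ t, 0 < f t) (hfmono : StrictMono f)
    (hlim : Tendsto f atTop atTop ∨ Tendsto κ atTop atTop)
    (hfin : ∀ a, IntegrableOn (fun t => 1 / linearSolution κ f a t ^ (1 / 2 : ℝ)) (Set.Ioi a))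
    (hR : ∀ a, R a = C * ∫⁻ t in Set.Ioi a,
      ENNReal.ofReal (1 / linearSolution κ f a t ^ (1 / 2 : ℝ))) :
    IsDecreasingToZero R ∧ Continuous R := by
  have hpos : ∀ a τ, 0 < τ → 0 < linearSolution κ f a (a + τ) := fun a τ hτ =>
    linearSolution_pos hκ hf hfpos (by linarith)
  refine isDecreasingToZero_of_shift hC0 hCtop hR ?_ ?_ ?_ ?_ ?_ fun a => (hfin a).lintegral_lt_top
  · intro a τ hτ
    have := hpos a τ hτ
    positivity
  · intro τ hτ a b hab
    exact one_div_lt_one_div_of_lt (Real.rpow_pos_of_pos (hpos a τ hτ) _)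
      (Real.rpow_lt_rpow (hpos a τ hτ).le
        (strictMono_linearSolution_shift hκ hf hκmono hfpos hfmono hτ hab) (by norm_num))
  · intro τ hτ
    exact continuous_const.div
      ((continuous_linearSolution_shift hκ hf τ).rpow_const fun _ => Or.inr (by norm_num))
      fun a => (Real.rpow_pos_of_pos (hpos a τ hτ) _).ne'
  · exact continuousOn_one_div_linearSolution hκ hf hfpos
  · intro τ hτ
    exact tendsto_one_div_rpow (by norm_num)
      (tendsto_linearSolution_shift hκ hf hκmono hfpos hfmono.monotone hlim hτ)

theorem one_div_linearSolution_le_near (hκ : Continuous κ)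
    (hκmono : Monotone κ) (hf : Continuous f) (hfpos : ∀ t, 0 < f t) (hfmono : StrictMono f)
    {a t T : ℝ} (hat : a < t) (htT : t ≤ T) :
    1 / linearSolution κ f a t ^ (1 / 2 : ℝ) ≤
      1 / (f a * Real.exp (-|κ a| * (T - a))) ^ (1 / 2 : ℝ) * (t - a) ^ (-(1 / 2) : ℝ) := by
  refine one_div_rpow_half_le (mul_pos (hfpos a) (Real.exp_pos _)) hat ?_
  refine le_trans ?_ (mul_exp_le_linearSolution hκ hf hκmono hfpos hfmono.monotone hat.le le_rfl)
  rw [mul_assoc]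
  refine mul_le_mul_of_nonneg_left ?_ (hfpos a).le
  rw [mul_comm]
  refine mul_le_mul_of_nonneg_left (Real.exp_le_exp.2 ?_) (by linarith)
  have := mul_le_mul_of_nonneg_left (sub_le_sub_right htT a) (abs_nonneg (κ a))
  linarith

/-- If `κ` is eventually bounded below by a positive constant, the solution grows exponentially. -/
theorem integrableOn_one_div_linearSolution_of_pos (hκ : Continuous κ) (hκmono : Monotone κ)
    (hf : Continuous f) (hfpos : ∀ t, 0 < f t) (hfmono : StrictMono f) {t₁ : ℝ}
    (ht₁ : 0 < κ t₁) (a : ℝ) :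
    IntegrableOn (fun t => 1 / linearSolution κ f a t ^ (1 / 2 : ℝ)) (Set.Ioi a) := by
  set b := max a t₁ with hb
  set c := κ t₁ with hc
  have hab : a ≤ b := le_max_left _ _
  set A : ℝ := (f b * Real.exp (-c * (b + 1))) ^ (1 / 2 : ℝ) with hA
  have hA0 : 0 < A := Real.rpow_pos_of_pos (mul_pos (hfpos b) (Real.exp_pos _)) _
  refine integrableOn_Ioi_of_le (T := b + 1) (h := fun t => 1 / A * Real.exp (-(c / 2) * t))
    (by linarith) (continuousOn_one_div_linearSolution hκ hf hfpos a) (fun t ht => ?_)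
    (fun t hat htT => one_div_linearSolution_le_near hκ hκmono hf hfpos hfmono hat htT)
    (fun t ht => ?_) ((exp_neg_integrableOn_Ioi _ (by positivity)).const_mul _)
  · have := linearSolution_pos hκ hf hfpos ht
    positivity
  · have h1 : f b * Real.exp (-c * (b + 1)) * Real.exp (c * t) ≤ linearSolution κ f a t := by
      refine le_trans ?_ (linearSolution_mono hκ hf hfpos t hab)
      refine le_trans ?_ (le_linearSolution hκ hf hκmono hfpos hfmono.monotone (by linarith)
        (hκmono (le_max_right a t₁)))
      rw [mul_assoc, ← Real.exp_add]
      refine mul_le_mul_of_nonneg_left ?_ (hfpos b).le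
      -- On `[b, b + 1]` the integrand is at least its value at `b + 1`.
      have h2 : ∫ _ in b..b + 1, Real.exp (-c * (b + 1) + c * t) ≤
          ∫ s in b..b + 1, Real.exp (c * (t - s)) := by
        refine intervalIntegral.integral_mono_on (by linarith) (by simp)
          (by apply Continuous.intervalIntegrable; fun_prop) fun s hs => Real.exp_le_exp.2 ?_
        have := mul_le_mul_of_nonneg_left hs.2 ht₁.le
        linarith
      have h3 : (∫ s in b..b + 1, Real.exp (c * (t - s))) +
          ∫ s in b + 1..t, Real.exp (c * (t - s)) = ∫ s in b..t, Real.exp (c * (t - s)) :=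
        intervalIntegral.integral_add_adjacent_intervals
          (by apply Continuous.intervalIntegrable; fun_prop)
          (by apply Continuous.intervalIntegrable; fun_prop)
      have h4 : 0 ≤ ∫ s in b + 1..t, Real.exp (c * (t - s)) :=
        integral_nonneg_of_nonneg (fun s => (Real.exp_pos _).le) ht.le
      have h5 : ∫ _ in b..b + 1, Real.exp (-c * (b + 1) + c * t) =
          Real.exp (-c * (b + 1) + c * t) := by simp
      linarith
    have h0 : 0 < f b * Real.exp (-c * (b + 1)) := mul_pos (hfpos b) (Real.exp_pos _)
    have h6 : A * Real.exp (c / 2 * t) ≤ linearSolution κ f a t ^ (1 / 2 : ℝ) := by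
      have h7 := Real.rpow_le_rpow (mul_pos h0 (Real.exp_pos _)).le h1
        (show (0 : ℝ) ≤ 1 / 2 by norm_num)
      rw [Real.mul_rpow h0.le (Real.exp_pos _).le, ← Real.exp_mul] at h7
      rwa [show c / 2 * t = c * t * (1 / 2) by ring]
    refine (one_div_le_one_div_of_le (mul_pos hA0 (Real.exp_pos _)) h6).trans (le_of_eq ?_)
    rw [one_div_mul_eq_div, neg_mul, Real.exp_neg]
    field_simp

/-- Integrability for one initial point yields integrability for all of them. -/
theorem integrableOn_one_div_linearSolution_of_zero (hκ : Continuous κ) (hκmono : Monotone κ)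
    (hf : Continuous f) (hfpos : ∀ t, 0 < f t) (hfmono : StrictMono f)
    (h0 : IntegrableOn (fun t => 1 / linearSolution κ f 0 t ^ (1 / 2 : ℝ)) (Set.Ioi 0)) (a : ℝ) :
    IntegrableOn (fun t => 1 / linearSolution κ f a t ^ (1 / 2 : ℝ)) (Set.Ioi a) := by
  have hle : ∀ t, 0 < t → linearSolution κ f 0 t ≤ linearSolution κ f (min a 0) t := fun t ht =>
    linearSolution_mono hκ hf hfpos t (min_le_right _ _)
  rcases le_total a 0 with ha | ha
  · refine integrableOn_Ioi_of_le (T := 0) ha (continuousOn_one_div_linearSolution hκ hf hfpos a)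
      (fun t ht => ?_)
      (fun t hat htT => one_div_linearSolution_le_near hκ hκmono hf hfpos hfmono hat htT)
      (fun t ht => ?_) h0
    · have := linearSolution_pos hκ hf hfpos ht
      positivity
    · have h1 := hle t ht
      rw [min_eq_left ha] at h1
      have h2 := linearSolution_pos hκ hf hfpos ht
      exact one_div_le_one_div_of_le (Real.rpow_pos_of_pos h2 _)
        (Real.rpow_le_rpow h2.le h1 (by norm_num))
  · -- The shifted solution is larger, by monotonicity in the initial point.
    have h1 : IntegrableOn (fun t => 1 / linearSolution κ f 0 (t - a) ^ (1 / 2 : ℝ))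
        (Set.Ioi a) := by
      have hm := (measurePreserving_sub_right (volume : Measure ℝ) a)
      have := (hm.integrableOn_comp_preimage
        (MeasurableEquiv.subRight a).measurableEmbedding).2 h0
      simpa [Function.comp_def] using this
    refine Integrable.mono' h1
      ((continuousOn_one_div_linearSolution hκ hf hfpos a).aestronglyMeasurable
        measurableSet_Ioi) ?_
    filter_upwards [ae_restrict_mem measurableSet_Ioi] with t ht
    have ht' : 0 < t - a := sub_pos.2 ht
    have h2 := linearSolution_pos hκ hf hfpos ht'
    have h3 := linearSolution_pos hκ hf hfpos (show a < t from ht)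
    have h4 := (strictMono_linearSolution_shift hκ hf hκmono hfpos hfmono ht').monotone ha
    simp only [zero_add, add_sub_cancel] at h4
    rw [Real.norm_of_nonneg (by positivity)]
    exact one_div_le_one_div_of_le (Real.rpow_pos_of_pos h2 _)
      (Real.rpow_le_rpow h2.le h4 (by norm_num))

end Radius

section Radius

variable {f h : ℝ → ℝ} {p q : ℝ} {R : ℝ → ℝ≥0∞} {C : ℝ≥0∞}

theorem continuousOn_one_div_add (hf : Continuous f) (hfpos : ∀ t, 0 < f t)
    (hh : Continuous h) (hh0 : ∀ t, 0 ≤ h t) (hp : 0 < p) (a : ℝ) :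
    ContinuousOn (fun t => 1 / ((∫ s in a..t, f s) ^ (1 / 2 : ℝ) + (∫ s in a..t, h s) ^ p))
      (Set.Ioi a) :=
  continuousOn_const.div
    (((continuous_integral hf a).rpow_const fun _ => Or.inr (by norm_num)).add
      ((continuous_integral hh a).rpow_const fun _ => Or.inr hp.le)).continuousOn
    fun _ ht => (add_pos_of_pos_of_nonneg (Real.rpow_pos_of_pos (integral_pos_of_pos hf hfpos ht) _)
      (Real.rpow_nonneg (integral_nonneg_of_nonneg hh0 (le_of_lt ht)) _)).ne'

theorem isDecreasingToZero_one_div_add (hC0 : C ≠ 0) (hCtop : C ≠ ⊤) (hf : Continuous f)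
    (hfpos : ∀ t, 0 < f t) (hfmono : StrictMono f) (hh : Continuous h) (hhmono : Monotone h)
    (hh0 : ∀ t, 0 ≤ h t) (hp : 0 < p) (hlim : Tendsto f atTop atTop ∨ Tendsto h atTop atTop)
    (hfin : ∀ a, IntegrableOn
      (fun t => 1 / ((∫ s in a..t, f s) ^ (1 / 2 : ℝ) + (∫ s in a..t, h s) ^ p)) (Set.Ioi a))
    (hR : ∀ a, R a = C * ∫⁻ t in Set.Ioi a,
      ENNReal.ofReal (1 / ((∫ s in a..t, f s) ^ (1 / 2 : ℝ) + (∫ s in a..t, h s) ^ p))) :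
    IsDecreasingToZero R ∧ Continuous R := by
  have hF : ∀ a τ, 0 < τ → 0 < ∫ s in a..a + τ, f s := fun a τ hτ =>
    integral_pos_of_pos hf hfpos (by linarith)
  have hH : ∀ a τ, 0 < τ → 0 ≤ ∫ s in a..a + τ, h s := fun a τ hτ =>
    integral_nonneg_of_nonneg hh0 (by linarith)
  have hpos : ∀ a τ, 0 < τ →
      0 < (∫ s in a..a + τ, f s) ^ (1 / 2 : ℝ) + (∫ s in a..a + τ, h s) ^ p := fun a τ hτ =>
    add_pos_of_pos_of_nonneg (Real.rpow_pos_of_pos (hF a τ hτ) _) (Real.rpow_nonneg (hH a τ hτ) _)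
  refine isDecreasingToZero_of_shift hC0 hCtop hR ?_ ?_ ?_
    (continuousOn_one_div_add hf hfpos hh hh0 hp) ?_ fun a => (hfin a).lintegral_lt_top
  · intro a τ hτ
    exact one_div_pos.2 (hpos a τ hτ)
  · intro τ hτ a b hab
    refine one_div_lt_one_div_of_lt (hpos a τ hτ) (add_lt_add_of_lt_of_le ?_ ?_)
    · exact Real.rpow_lt_rpow (hF a τ hτ).le (strictMono_integral_shift hf hfmono hτ hab)
        (by norm_num)
    · exact Real.rpow_le_rpow (hH a τ hτ) (monotone_integral_shift hh hhmono hτ.le hab.le) hp.le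
  · intro τ hτ
    exact continuous_const.div
      (((continuous_integral_shift hf τ).rpow_const fun _ => Or.inr (by norm_num)).add
      ((continuous_integral_shift hh τ).rpow_const fun _ => Or.inr hp.le))
      fun a => (hpos a τ hτ).ne'
  · intro τ hτ
    refine Tendsto.congr (fun a => (one_div _).symm) (Tendsto.inv_tendsto_atTop ?_)
    rcases hlim with hlim | hlim
    · exact tendsto_atTop_mono (fun a => le_add_of_nonneg_right (Real.rpow_nonneg (hH a τ hτ) _))
        ((tendsto_rpow_atTop (by norm_num)).comp
          (tendsto_integral_shift hf hfmono.monotone hlim hτ))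
    · exact tendsto_atTop_mono
        (fun a => le_add_of_nonneg_left (Real.rpow_nonneg (hF a τ hτ).le _))
        ((tendsto_rpow_atTop hp).comp (tendsto_integral_shift hh hhmono hlim hτ))

theorem one_div_integral_le_near (hf : Continuous f) (hfpos : ∀ t, 0 < f t)
    (hfmono : StrictMono f) {a t : ℝ} (hat : a < t) :
    1 / (∫ s in a..t, f s) ^ (1 / 2 : ℝ) ≤
      1 / f a ^ (1 / 2 : ℝ) * (t - a) ^ (-(1 / 2) : ℝ) := by
  refine one_div_rpow_half_le (hfpos a) hat ?_
  rw [mul_comm]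
  exact mul_le_integral_of_monotone hf hfmono.monotone hat.le

theorem one_div_add_le_near (hf : Continuous f) (hfpos : ∀ t, 0 < f t) (hfmono : StrictMono f)
    (hh0 : ∀ t, 0 ≤ h t) {a t : ℝ} (hat : a < t) :
    1 / ((∫ s in a..t, f s) ^ (1 / 2 : ℝ) + (∫ s in a..t, h s) ^ p) ≤
      1 / f a ^ (1 / 2 : ℝ) * (t - a) ^ (-(1 / 2) : ℝ) :=
  (one_div_le_one_div_of_le (Real.rpow_pos_of_pos (integral_pos_of_pos hf hfpos hat) _)
    (le_add_of_nonneg_right (Real.rpow_nonneg (integral_nonneg_of_nonneg hh0 hat.le) _))).trans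
    (one_div_integral_le_near hf hfpos hfmono hat)

/-- If `p > 1` and `h` is eventually bounded below by a positive constant, the term `(∫ h)^p` grows
faster than linearly. -/
theorem integrableOn_one_div_add_of_one_lt (hf : Continuous f) (hfpos : ∀ t, 0 < f t)
    (hfmono : StrictMono f) (hh : Continuous h) (hhmono : Monotone h) (hh0 : ∀ t, 0 ≤ h t)
    (hp : 1 < p) {t₁ : ℝ} (ht₁ : 0 < h t₁) (a : ℝ) :
    IntegrableOn (fun t => 1 / ((∫ s in a..t, f s) ^ (1 / 2 : ℝ) + (∫ s in a..t, h s) ^ p))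
      (Set.Ioi a) := by
  set b := max a t₁ with hb
  have hab : a ≤ b := le_max_left _ _
  have hfar : IntegrableOn (fun t => 1 / h t₁ ^ p * (t - b) ^ (-p)) (Set.Ioi (b + 1)) := by
    have h1 := integrableOn_Ioi_rpow_of_lt (show -p < -1 by linarith) one_pos
    have hm := (measurePreserving_sub_right (volume : Measure ℝ) b)
    have := (hm.integrableOn_comp_preimage
      (MeasurableEquiv.subRight b).measurableEmbedding).2 h1
    simp only [Set.preimage_sub_const_Ioi, add_comm (1 : ℝ)] at this
    exact this.const_mul _
  refine integrableOn_Ioi_of_le (T := b + 1) (by linarith)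
    (continuousOn_one_div_add hf hfpos hh hh0 (by linarith) a) (fun t ht => ?_)
    (fun t hat _ => one_div_add_le_near hf hfpos hfmono hh0 hat) (fun t ht => ?_) hfar
  · exact one_div_nonneg.2 (add_nonneg
      (Real.rpow_nonneg (integral_pos_of_pos hf hfpos ht).le _)
      (Real.rpow_nonneg (integral_nonneg_of_nonneg hh0 ht.le) _))
  · have htb : 0 < t - b := by linarith
    have hat : a < t := by linarith
    have h1 : h t₁ * (t - b) ≤ ∫ s in a..t, h s := by
      have h2 := mul_le_integral_of_monotone hh hhmono (show b ≤ t by linarith)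
      have h3 : (∫ s in a..b, h s) + ∫ s in b..t, h s = ∫ s in a..t, h s :=
        intervalIntegral.integral_add_adjacent_intervals (hh.intervalIntegrable _ _)
          (hh.intervalIntegrable _ _)
      have h4 := integral_nonneg_of_nonneg hh0 hab
      have h5 := mul_le_mul_of_nonneg_left (hhmono (le_max_right a t₁)) htb.le
      rw [← hb] at h5
      linarith
    rw [Real.rpow_neg htb.le, ← one_div, one_div_mul_one_div, ← Real.mul_rpow ht₁.le htb.le]
    refine one_div_le_one_div_of_le (Real.rpow_pos_of_pos (mul_pos ht₁ htb) _) ?_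
    refine (Real.rpow_le_rpow (mul_pos ht₁ htb).le h1 (by linarith)).trans ?_
    exact le_add_of_nonneg_left (Real.rpow_nonneg (integral_pos_of_pos hf hfpos hat).le _)

theorem integrableOn_one_div_add_of_integrableOn (hf : Continuous f) (hfpos : ∀ t, 0 < f t)
    (hfmono : StrictMono f) (hh : Continuous h) (hhmono : Monotone h) (hh0 : ∀ t, 0 ≤ h t)
    (hp : 0 < p)
    (hint : IntegrableOn (fun t => 1 / ((t * f t) ^ (1 / 2 : ℝ) + (t * h t) ^ p)) (Set.Ioi 0))
    (a : ℝ) :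
    IntegrableOn (fun t => 1 / ((∫ s in a..t, f s) ^ (1 / 2 : ℝ) + (∫ s in a..t, h s) ^ p))
      (Set.Ioi a) := by
  have hT0 : 0 ≤ 2 * |a| := by positivity
  have haT : a ≤ 2 * |a| := by linarith [le_abs_self a, abs_nonneg a]
  refine integrableOn_Ioi_of_le (T := 2 * |a|) haT
    (continuousOn_one_div_add hf hfpos hh hh0 hp a) (fun t ht => ?_)
    (fun t hat _ => one_div_add_le_near hf hfpos hfmono hh0 hat) (fun t ht => ?_)
    (integrableOn_comp_half hint hT0)
  · exact one_div_nonneg.2 (add_nonneg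
      (Real.rpow_nonneg (integral_pos_of_pos hf hfpos ht).le _)
      (Real.rpow_nonneg (integral_nonneg_of_nonneg hh0 ht.le) _))
  · have ht0 : 0 < t / 2 := by linarith
    have hat : a ≤ t / 2 := by linarith [le_abs_self a]
    have h1 := half_mul_le_integral hf hfmono.monotone (fun t => (hfpos t).le) (by linarith) hat
    have h2 := half_mul_le_integral hh hhmono hh0 (by linarith) hat
    have h3 : 0 < t / 2 * f (t / 2) := mul_pos ht0 (hfpos _)
    have h4 : 0 ≤ t / 2 * h (t / 2) := mul_nonneg ht0.le (hh0 _)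
    exact one_div_le_one_div_of_le
      (add_pos_of_pos_of_nonneg (Real.rpow_pos_of_pos h3 _) (Real.rpow_nonneg h4 _))
      (add_le_add (Real.rpow_le_rpow h3.le h1 (by norm_num)) (Real.rpow_le_rpow h4 h2 hp.le))

theorem continuousOn_one_div_add_div (hf : Continuous f) (hfpos : ∀ t, 0 < f t)
    (hh : Continuous h) (hp : 0 < p) (a : ℝ) :
    ContinuousOn (fun t => 1 / (∫ s in a..t, f s) ^ (1 / 2 : ℝ) +
      ((∫ s in a..t, h s) / (∫ s in a..t, f s)) ^ p) (Set.Ioi a) := by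
  have hpos : ∀ t ∈ Set.Ioi a, 0 < ∫ s in a..t, f s := fun t ht => integral_pos_of_pos hf hfpos ht
  refine ContinuousOn.add ?_ ?_
  · exact continuousOn_const.div ((continuous_integral hf a).rpow_const
      fun _ => Or.inr (by norm_num)).continuousOn
      fun t ht => (Real.rpow_pos_of_pos (hpos t ht) _).ne'
  · exact ((continuous_integral hh a).continuousOn.div (continuous_integral hf a).continuousOn
      fun t ht => (hpos t ht).ne').rpow_const fun _ _ => Or.inr hp.le

theorem isDecreasingToZero_one_div_add_div (hC0 : C ≠ 0) (hCtop : C ≠ ⊤) (hf : Continuous f)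
    (hfpos : ∀ t, 0 < f t) (hfmono : StrictMono f) (hh : Continuous h) (hhanti : Antitone h)
    (hh0 : ∀ t, 0 ≤ h t) (hp : 0 < p) (hlim : Tendsto f atTop atTop)
    (hfin : ∀ a, IntegrableOn (fun t => 1 / (∫ s in a..t, f s) ^ (1 / 2 : ℝ) +
      ((∫ s in a..t, h s) / (∫ s in a..t, f s)) ^ p) (Set.Ioi a))
    (hR : ∀ a, R a = C * ∫⁻ t in Set.Ioi a, ENNReal.ofReal (1 / (∫ s in a..t, f s) ^ (1 / 2 : ℝ) +
      ((∫ s in a..t, h s) / (∫ s in a..t, f s)) ^ p)) :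
    IsDecreasingToZero R ∧ Continuous R := by
  have hF : ∀ a τ, 0 < τ → 0 < ∫ s in a..a + τ, f s := fun a τ hτ =>
    integral_pos_of_pos hf hfpos (by linarith)
  have hH : ∀ a τ, 0 < τ → 0 ≤ ∫ s in a..a + τ, h s := fun a τ hτ =>
    integral_nonneg_of_nonneg hh0 (by linarith)
  have hHanti : ∀ τ, 0 < τ → Antitone fun a => ∫ s in a..a + τ, h s := by
    intro τ hτ a b hab
    have := monotone_integral_shift (f := fun s => -h s) hh.neg hhanti.neg hτ.le hab
    simp only [intervalIntegral.integral_neg] at this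
    exact neg_le_neg_iff.1 this
  have hQ : ∀ a τ, 0 < τ → 0 ≤ (∫ s in a..a + τ, h s) / ∫ s in a..a + τ, f s := fun a τ hτ =>
    div_nonneg (hH a τ hτ) (hF a τ hτ).le
  refine isDecreasingToZero_of_shift hC0 hCtop hR ?_ ?_ ?_
    (continuousOn_one_div_add_div hf hfpos hh hp) ?_ fun a => (hfin a).lintegral_lt_top
  · intro a τ hτ
    exact add_pos_of_pos_of_nonneg (one_div_pos.2 (Real.rpow_pos_of_pos (hF a τ hτ) _))
      (Real.rpow_nonneg (hQ a τ hτ) _)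
  · intro τ hτ a b hab
    have hlt := strictMono_integral_shift hf hfmono hτ hab
    refine add_lt_add_of_lt_of_le ?_ ?_
    · exact one_div_lt_one_div_of_lt (Real.rpow_pos_of_pos (hF a τ hτ) _)
        (Real.rpow_lt_rpow (hF a τ hτ).le hlt (by norm_num))
    · exact Real.rpow_le_rpow (hQ b τ hτ)
        (div_le_div₀ (hH a τ hτ) (hHanti τ hτ hab.le) (hF a τ hτ) hlt.le) hp.le
  · intro τ hτ
    refine Continuous.add ?_ ?_
    · exact continuous_const.div ((continuous_integral_shift hf τ).rpow_const
        fun _ => Or.inr (by norm_num)) fun a => (Real.rpow_pos_of_pos (hF a τ hτ) _).ne'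
    · exact ((continuous_integral_shift hh τ).div (continuous_integral_shift hf τ)
        fun a => (hF a τ hτ).ne').rpow_const fun _ => Or.inr hp.le
  · intro τ hτ
    have hFlim := tendsto_integral_shift hf hfmono.monotone hlim hτ
    have h1 : Tendsto (fun a => (∫ s in a..a + τ, h s) / ∫ s in a..a + τ, f s) atTop (𝓝 0) := by
      refine squeeze_zero' (Eventually.of_forall fun a => hQ a τ hτ) ?_
        (hFlim.const_div_atTop (∫ s in (0 : ℝ)..0 + τ, h s))
      filter_upwards [eventually_ge_atTop 0] with a ha
      exact div_le_div_of_nonneg_right (hHanti τ hτ ha) (hF a τ hτ).le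
    have h2 := (Real.continuousAt_rpow_const 0 p (Or.inr hp.le)).tendsto.comp h1
    rw [Real.zero_rpow hp.ne'] at h2
    have h3 := (tendsto_one_div_rpow (p := 1 / 2) (by norm_num) hFlim).add h2
    rw [add_zero] at h3
    exact h3

theorem integrableOn_one_div_add_div (hf : Continuous f) (hfpos : ∀ t, 0 < f t)
    (hfmono : StrictMono f) (hh : Continuous h) (hhanti : Antitone h) (hh0 : ∀ t, 0 ≤ h t)
    (hp : 0 < p)
    (hint : IntegrableOn (fun t => 1 / (t * f t) ^ (1 / 2 : ℝ) + 1 / f t ^ p) (Set.Ioi 0))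
    (a : ℝ) :
    IntegrableOn (fun t => 1 / (∫ s in a..t, f s) ^ (1 / 2 : ℝ) +
      ((∫ s in a..t, h s) / (∫ s in a..t, f s)) ^ p) (Set.Ioi a) := by
  set T := 2 * |a| + 1 with hT
  have hT0 : 0 ≤ T := by positivity
  have haT : a ≤ T := by linarith [le_abs_self a, abs_nonneg a]
  -- `M` bounds the quotient of `∫ h` and `(t/2) f(t/2)`, up to the factor `1/f(t/2)`.
  set M : ℝ := max 1 ((4 * h a) ^ p) with hM
  have hQ : ∀ t, a < t → 0 ≤ (∫ s in a..t, h s) / ∫ s in a..t, f s := fun t ht =>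
    div_nonneg (integral_nonneg_of_nonneg hh0 ht.le) (integral_pos_of_pos hf hfpos ht).le
  refine integrableOn_Ioi_of_le (T := T)
    (C := 1 / f a ^ (1 / 2 : ℝ) + (h a / f a) ^ p * (T - a) ^ (1 / 2 : ℝ))
    (h := fun t => M * (1 / (t / 2 * f (t / 2)) ^ (1 / 2 : ℝ) + 1 / f (t / 2) ^ p)) haT
    (continuousOn_one_div_add_div hf hfpos hh hp a) (fun t ht => ?_)
    (fun t hat htT => ?_) (fun t ht => ?_) ((integrableOn_comp_half hint hT0).const_mul _)
  · exact add_nonneg (one_div_nonneg.2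
      (Real.rpow_nonneg (integral_pos_of_pos hf hfpos ht).le _)) (Real.rpow_nonneg (hQ t ht) _)
  · have hta : 0 < t - a := sub_pos.2 hat
    rw [add_mul]
    refine add_le_add (one_div_integral_le_near hf hfpos hfmono hat) ?_
    have h1 : (∫ s in a..t, h s) / ∫ s in a..t, f s ≤ h a / f a := by
      have h2 := integral_le_mul_of_antitone hh hhanti hat.le
      have h3 := mul_le_integral_of_monotone hf hfmono.monotone hat.le
      refine (div_le_div₀ (mul_nonneg hta.le (hh0 a)) h2 (mul_pos hta (hfpos a)) h3).trans
        (le_of_eq ?_)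
      exact mul_div_mul_left _ _ hta.ne'
    refine (Real.rpow_le_rpow (hQ t hat) h1 hp.le).trans ?_
    rw [mul_assoc]
    refine le_mul_of_one_le_right (Real.rpow_nonneg (div_nonneg (hh0 a) (hfpos a).le) _) ?_
    rw [Real.rpow_neg hta.le, ← div_eq_mul_inv, one_le_div (Real.rpow_pos_of_pos hta _)]
    exact Real.rpow_le_rpow hta.le (by linarith) (by norm_num)
  · have ht0 : 0 < t / 2 := by linarith
    have hat2 : a ≤ t / 2 := by linarith [le_abs_self a]
    have hat : a < t := by linarith
    have hft := hfpos (t / 2)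
    have h1 := half_mul_le_integral hf hfmono.monotone (fun t => (hfpos t).le) (by linarith) hat2
    have h3 : 0 < t / 2 * f (t / 2) := mul_pos ht0 hft
    have h4 : 0 ≤ 1 / (t / 2 * f (t / 2)) ^ (1 / 2 : ℝ) := by positivity
    rw [mul_add]
    refine add_le_add ?_ ?_
    · refine le_trans (one_div_le_one_div_of_le (Real.rpow_pos_of_pos h3 _)
        (Real.rpow_le_rpow h3.le h1 (by norm_num))) ?_
      exact le_mul_of_one_le_left h4 (le_max_left _ _)
    · have h5 : (∫ s in a..t, h s) / ∫ s in a..t, f s ≤ 4 * h a / f (t / 2) := by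
        have h2 := integral_le_mul_of_antitone hh hhanti hat.le
        have h6 : (t - a) * h a ≤ 2 * t * h a :=
          mul_le_mul_of_nonneg_right (by linarith [neg_abs_le a]) (hh0 a)
        refine (div_le_div₀ (mul_nonneg (by linarith) (hh0 a)) (h2.trans h6) h3 h1).trans
          (le_of_eq ?_)
        have : t ≠ 0 := by linarith
        field_simp
        ring
      refine (Real.rpow_le_rpow (hQ t hat) h5 hp.le).trans ?_
      rw [Real.div_rpow (mul_nonneg (by norm_num) (hh0 a)) hft.le, div_eq_mul_one_div]
      exact mul_le_mul_of_nonneg_right (le_max_right _ _)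
        (one_div_nonneg.2 (Real.rpow_nonneg hft.le _))

end Radius

/-! ### The universal bounds -/

section UniversalBounds

variable {n : ℕ} {q : ℝ} {f g : ℝ → ℝ} {γ : EReal}

theorem HasUniversalBound.of_barriers_bot {R : ℝ → ℝ≥0∞}
    (hR : IsDecreasingToZero R) (hRc : Continuous R)
    (h : ∀ a : ℝ, ∀ F : Space n → Matrix (Fin n) (Fin n) ℝ → ℝ, IsDegenerateElliptic F →
      ∀ (Ω : Set (Space n)) (u : Space n → ℝ), IsViscositySubsolution F f g q Ω u →
        ∀ x d, Metric.ball x d ⊆ Ω → R a < ENNReal.ofReal d → u x ≤ a) :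
    HasUniversalBound n f g q fun d => inverse R d := by
  have := HasUniversalBound.of_barriers hR hRc ⊥ fun a _ => h a
  simpa only [bot_sup_eq] using this

theorem continuous_posPart (hg : Continuous g) : Continuous fun s => (g s)⁺ := by
  simp only [posPart_def]
  fun_prop

theorem continuous_negPart (hg : Continuous g) : Continuous fun s => (g s)⁻ := by
  simp only [negPart_def]
  fun_prop

theorem nonneg_of_threshold_lt (hgmono : Monotone g) {a t : ℝ} (ha : threshold g < a)
    (hat : a < t) : 0 ≤ g t := by
  obtain ⟨_, ⟨s, hs, rfl⟩, hsa⟩ := sInf_lt_iff.1 ha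
  exact (show 0 ≤ g s from hs).trans (hgmono ((EReal.coe_lt_coe_iff.1 hsa).trans hat).le)

theorem tendsto_atTop_or (hγ : Tendsto (fun t : ℝ => (g t : EReal)) atTop (𝓝 γ))
    (hfg : γ < ⊤ → Tendsto f atTop atTop) : Tendsto f atTop atTop ∨ Tendsto g atTop atTop := by
  rcases lt_or_ge γ ⊤ with h | h
  · exact Or.inl (hfg h)
  · rw [top_le_iff.1 h] at hγ
    exact Or.inr (EReal.tendsto_coe_nhds_top_iff.1 hγ)

theorem radiusPos_spec_of_lt_two (hn : 1 ≤ n) (hq0 : 0 < q) (hq2 : q < 2)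
    (hf : Continuous f) (hg : Continuous g) (hfpos : ∀ t, 0 < f t) (hfmono : StrictMono f)
    (hgmono : Monotone g) (hlim : Tendsto f atTop atTop ∨ Tendsto g atTop atTop)
    (hpos : ∃ t, 0 < g t) (hcond : ¬ ConditionPos f g q) :
    IsDecreasingToZero (radiusPos n f g q) ∧
      HasUniversalBound n f g q
        (fun d => max (threshold g) (inverse (radiusPos n f g q) d)) := by
  have hx : 0 < 2 - q := by linarith
  have hn0 : (0 : ℝ) < n := by exact_mod_cast hn
  have hp : 0 < 1 / (2 - q) := by positivity
  have hgp := continuous_posPart hg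
  have hgpmono : Monotone fun s => (g s)⁺ := fun s t hst => posPart_mono (hgmono hst)
  have hgp0 : ∀ t, 0 ≤ (g t)⁺ := fun t => posPart_nonneg _
  have hR : ∀ a, radiusPos n f g q a = ENNReal.ofReal (2 * ((n : ℝ) / (2 - q)) ^ (1 / (2 - q))) *
      ∫⁻ t in Set.Ioi a, ENNReal.ofReal (1 / ((∫ s in a..t, f s) ^ (1 / 2 : ℝ) +
        (∫ s in a..t, (g s)⁺) ^ (1 / (2 - q)))) := fun a => if_pos hq2
  have hfin : ∀ a, IntegrableOn (fun t => 1 / ((∫ s in a..t, f s) ^ (1 / 2 : ℝ) +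
      (∫ s in a..t, (g s)⁺) ^ (1 / (2 - q)))) (Set.Ioi a) := by
    rcases le_or_gt q 1 with hq1 | hq1
    · refine integrableOn_one_div_add_of_integrableOn hf hfpos hfmono hgp hgpmono hgp0 hp ?_
      have hden : ∀ t, 0 < t → 0 < (t * f t) ^ (1 / 2 : ℝ) + (t * (g t)⁺) ^ (1 / (2 - q)) :=
        fun t ht => add_pos_of_pos_of_nonneg (Real.rpow_pos_of_pos (mul_pos ht (hfpos t)) _)
          (Real.rpow_nonneg (mul_nonneg ht.le (hgp0 t)) _)
      refine integrableOn_of_lintegral_ne_top ?_ (fun t ht => (one_div_pos.2 (hden t ht)).le)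
        fun h => hcond ⟨hq1, h⟩
      refine continuousOn_const.div (Continuous.continuousOn ?_) fun t ht => (hden t ht).ne'
      exact ((continuous_id.mul hf).rpow_const fun _ => Or.inr (by norm_num)).add
        ((continuous_id.mul hgp).rpow_const fun _ => Or.inr hp.le)
    · obtain ⟨t₁, ht₁⟩ := hpos
      refine integrableOn_one_div_add_of_one_lt hf hfpos hfmono hgp hgpmono hgp0 ?_
        (posPart_pos_iff.2 ht₁)
      rw [lt_div_iff₀ hx]
      linarith
  have hlim' : Tendsto f atTop atTop ∨ Tendsto (fun s => (g s)⁺) atTop atTop :=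
    hlim.imp_right fun h => tendsto_atTop_mono (fun t => le_posPart (g t)) h
  obtain ⟨hdec, hcont⟩ := isDecreasingToZero_one_div_add
    (ENNReal.ofReal_pos.2 (by positivity)).ne' ENNReal.ofReal_ne_top hf hfpos hfmono hgp hgpmono
    hgp0 hp hlim' hfin hR
  refine ⟨hdec, HasUniversalBound.of_barriers hdec hcont _ ?_⟩
  intro a ha F hF Ω u hu x d hball hd
  rw [hR] at hd
  exact hu.le_of_radiusPos_lt hn hq0 hq2 hf hfpos hfmono hgmono hgp hgpmono hgp0
    (fun t hat => (posPart_of_nonneg (nonneg_of_threshold_lt hgmono ha hat)).symm) hF hball hd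

theorem radiusPos_spec_two (hn : 1 ≤ n)
    (hf : Continuous f) (hg : Continuous g) (hfpos : ∀ t, 0 < f t) (hfmono : StrictMono f)
    (hgmono : Monotone g) (hlim : Tendsto f atTop atTop ∨ Tendsto g atTop atTop)
    (hpos : ∃ t, 0 < g t) :
    IsDecreasingToZero (radiusPos n f g 2) ∧
      HasUniversalBound n f g 2
        (fun d => max (threshold g) (inverse (radiusPos n f g 2) d)) := by
  have hn0 : (0 : ℝ) < n := by exact_mod_cast hn
  have hgp := continuous_posPart hg
  have hgpmono : Monotone fun s => (g s)⁺ := fun s t hst => posPart_mono (hgmono hst)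
  have hgp0 : ∀ t, 0 ≤ (g t)⁺ := fun t => posPart_nonneg _
  have h2n : (0 : ℝ) < 2 / n := by positivity
  have hκ : Continuous fun r => 2 / (n : ℝ) * (g r)⁺ := continuous_const.mul hgp
  have hκmono : Monotone fun r => 2 / (n : ℝ) * (g r)⁺ := hgpmono.const_mul h2n.le
  have hR : ∀ a, radiusPos n f g 2 a = ENNReal.ofReal (Real.sqrt ((n : ℝ) / 2)) *
      ∫⁻ t in Set.Ioi a, ENNReal.ofReal
        (1 / linearSolution (fun r => 2 / (n : ℝ) * (g r)⁺) f a t ^ (1 / 2 : ℝ)) := by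
    intro a
    simp only [linearSolution, intervalIntegral.integral_const_mul]
    exact if_neg (lt_irrefl _)
  have hfin : ∀ a, IntegrableOn (fun t =>
      1 / linearSolution (fun r => 2 / (n : ℝ) * (g r)⁺) f a t ^ (1 / 2 : ℝ)) (Set.Ioi a) := by
    obtain ⟨t₁, ht₁⟩ := hpos
    exact integrableOn_one_div_linearSolution_of_pos hκ hκmono hf hfpos hfmono (t₁ := t₁)
      (mul_pos h2n (posPart_pos_iff.2 ht₁))
  have hlim' : Tendsto f atTop atTop ∨ Tendsto (fun r => 2 / (n : ℝ) * (g r)⁺) atTop atTop :=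
    hlim.imp_right fun h =>
      (tendsto_atTop_mono (fun t => le_posPart (g t)) h).const_mul_atTop h2n
  obtain ⟨hdec, hcont⟩ := isDecreasingToZero_linearSolution
    (ENNReal.ofReal_pos.2 (by positivity)).ne' ENNReal.ofReal_ne_top hκ hκmono hf hfpos hfmono
    hlim' hfin hR
  refine ⟨hdec, HasUniversalBound.of_barriers hdec hcont _ ?_⟩
  intro a ha F hF Ω u hu x d hball hd
  rw [hR] at hd
  exact hu.le_of_radiusPos_two_lt hn hf hfpos hfmono hgmono hgp hgpmono hgp0
    (fun t hat => (posPart_of_nonneg (nonneg_of_threshold_lt hgmono ha hat)).symm) hF hball hd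

theorem radiusZero_spec (hn : 1 ≤ n) (hq0 : 0 < q) (hq2 : q ≤ 2)
    (hf : Continuous f) (hg : Continuous g) (hfpos : ∀ t, 0 < f t) (hfmono : StrictMono f)
    (hgmono : Monotone g) (hlim : Tendsto f atTop atTop) (hg0 : ∀ t, g t ≤ 0)
    (hcond : ¬ ConditionZero f g q) :
    IsDecreasingToZero (radiusZero n f g q) ∧
      HasUniversalBound n f g q (fun d => inverse (radiusZero n f g q) d) := by
  have hn0 : (0 : ℝ) < n := by exact_mod_cast hn
  have hgm := continuous_negPart hg
  have hgmanti : Antitone fun s => (g s)⁻ := fun s t hst => negPart_anti (hgmono hst)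
  have hgm0 : ∀ t, 0 ≤ (g t)⁻ := fun t => negPart_nonneg _
  have hm0 : ∀ t, 0 ≤ (g t)⁻ / f t := fun t => div_nonneg (hgm0 t) (hfpos t).le
  set κ : ℝ → ℝ := fun r => -2 * (((g r)⁻ / f r) ^ (2 / q) * f r) with hκdef
  have hκ : Continuous κ := continuous_const.mul
    (((hgm.div hf fun t => (hfpos t).ne').rpow_const fun _ => Or.inr (by positivity)).mul hf)
  -- `(g⁻/f)^{2/q} f = (g⁻)^{2/q} f^{1-2/q}` is nonincreasing because `q ≤ 2`.
  have hκmono : Monotone κ := by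
    intro s t hst
    have hform : ∀ r, ((g r)⁻ / f r) ^ (2 / q) * f r = (g r)⁻ ^ (2 / q) * f r ^ (1 - 2 / q) := by
      intro r
      rw [Real.div_rpow (hgm0 r) (hfpos r).le, Real.rpow_sub (hfpos r), Real.rpow_one]
      ring
    have h1 : (g t)⁻ ^ (2 / q) ≤ (g s)⁻ ^ (2 / q) :=
      Real.rpow_le_rpow (hgm0 t) (hgmanti hst) (by positivity)
    have h2 : f t ^ (1 - 2 / q) ≤ f s ^ (1 - 2 / q) := by
      refine Real.rpow_le_rpow_of_nonpos (hfpos s) (hfmono.monotone hst) ?_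
      rw [sub_nonpos, le_div_iff₀ hq0]
      linarith
    have h3 := mul_le_mul h1 h2 (Real.rpow_nonneg (hfpos t).le _) (Real.rpow_nonneg (hgm0 s) _)
    simp only [hκdef, hform]
    linarith
  have hdamped : ∀ a t, dampedPrimitive f g q a t = linearSolution κ f a t := by
    intro a t
    simp only [dampedPrimitive, linearSolution, hκdef, intervalIntegral.integral_const_mul]
  have hR : ∀ a, radiusZero n f g q a = ENNReal.ofReal ((n : ℝ) ^ (1 / q) / Real.sqrt q) *
      ∫⁻ t in Set.Ioi a, ENNReal.ofReal (1 / linearSolution κ f a t ^ (1 / 2 : ℝ)) := by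
    intro a
    simp only [radiusZero, hdamped]
  have hfin : ∀ a, IntegrableOn (fun t => 1 / linearSolution κ f a t ^ (1 / 2 : ℝ))
      (Set.Ioi a) := by
    refine integrableOn_one_div_linearSolution_of_zero hκ hκmono hf hfpos hfmono ?_
    refine integrableOn_of_lintegral_ne_top (continuousOn_one_div_linearSolution hκ hf hfpos 0)
      (fun t ht => ?_) ?_
    · have := linearSolution_pos hκ hf hfpos ht
      positivity
    · simpa only [ConditionZero, hdamped] using hcond
  obtain ⟨hdec, hcont⟩ := isDecreasingToZero_linearSolution
    (ENNReal.ofReal_pos.2 (by positivity)).ne' ENNReal.ofReal_ne_top hκ hκmono hf hfpos hfmono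
    (Or.inl hlim) hfin hR
  refine ⟨hdec, HasUniversalBound.of_barriers_bot hdec hcont ?_⟩
  intro a F hF Ω u hu x d hball hd
  rw [hR] at hd
  exact hu.le_of_radiusZero_lt hn hq0 hq2 hf hfpos hfmono hgmono hgm hgmanti hgm0
    (fun t => by rw [negPart_of_nonpos (hg0 t), neg_neg]) hF hball hd

theorem radiusNeg_spec (hn : 1 ≤ n) (hq0 : 0 < q) (hq2 : q ≤ 2)
    (hf : Continuous f) (hg : Continuous g) (hfpos : ∀ t, 0 < f t) (hfmono : StrictMono f)
    (hgmono : Monotone g) (hlim : Tendsto f atTop atTop) (hg0 : ∀ t, g t < 0)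
    (hcond : ¬ ConditionNeg f q) :
    IsDecreasingToZero (radiusNeg n f g q) ∧
      HasUniversalBound n f g q (fun d => inverse (radiusNeg n f g q) d) := by
  have hn0 : (0 : ℝ) < n := by exact_mod_cast hn
  have hp : 0 < 1 / q := by positivity
  have hgm := continuous_negPart hg
  have hgmanti : Antitone fun s => (g s)⁻ := fun s t hst => negPart_anti (hgmono hst)
  have hgm0 : ∀ t, 0 < (g t)⁻ := fun t => negPart_pos_iff.2 (hg0 t)
  have hint : IntegrableOn (fun t => 1 / (t * f t) ^ (1 / 2 : ℝ) + 1 / f t ^ (1 / q))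
      (Set.Ioi 0) := by
    refine integrableOn_of_lintegral_ne_top ?_ (fun t ht => ?_) hcond
    · refine ContinuousOn.add ?_ ?_
      · exact continuousOn_const.div ((continuous_id.mul hf).rpow_const
          fun _ => Or.inr (by norm_num)).continuousOn
          fun t ht => (Real.rpow_pos_of_pos (mul_pos ht (hfpos t)) _).ne'
      · exact continuousOn_const.div (hf.rpow_const fun t => Or.inr hp.le).continuousOn
          fun t ht => (Real.rpow_pos_of_pos (hfpos t) _).ne'
    · have := hfpos t
      positivity
  have hfin := integrableOn_one_div_add_div hf hfpos hfmono hgm hgmanti (fun t => (hgm0 t).le)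
    hp hint
  obtain ⟨hdec, hcont⟩ := isDecreasingToZero_one_div_add_div (R := radiusNeg n f g q)
    (C := ENNReal.ofReal (2 * ((n : ℝ) ^ (1 / q) / q)))
    (ENNReal.ofReal_pos.2 (by positivity)).ne' ENNReal.ofReal_ne_top hf hfpos hfmono hgm hgmanti
    (fun t => (hgm0 t).le) hp hlim hfin fun a => rfl
  refine ⟨hdec, HasUniversalBound.of_barriers_bot hdec hcont ?_⟩
  intro a F hF Ω u hu x d hball hd
  exact hu.le_of_radiusNeg_lt hn hq0 hq2 hf hfpos hfmono hgmono hgm hgmanti hgm0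
    (fun t => by rw [negPart_of_nonpos (hg0 t).le, neg_neg]) hF hball hd

end UniversalBounds

end KellerOsserman

theorem mainTheorem2 (n : ℕ) (hn : 1 ≤ n) (q : ℝ) (hq0 : 0 < q) (hq2 : q ≤ 2)
    (f g : ℝ → ℝ) (hf : Continuous f) (hg : Continuous g)
    (hfpos : ∀ t, 0 < f t) (hfmono : StrictMono f) (hgmono : Monotone g)
    (γ : EReal) (hγ : Tendsto (fun t : ℝ => (g t : EReal)) atTop (𝓝 γ))
    (hfg : γ < ⊤ → Tendsto f atTop atTop) :
    (0 < γ → ¬ KellerOsserman.ConditionPos f g q →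
      KellerOsserman.IsDecreasingToZero (KellerOsserman.radiusPos n f g q) ∧
      KellerOsserman.HasUniversalBound n f g q (fun d =>
        max (KellerOsserman.threshold g)
          (KellerOsserman.inverse (KellerOsserman.radiusPos n f g q) d))) ∧
    (γ = 0 → ¬ KellerOsserman.ConditionZero f g q →
      KellerOsserman.IsDecreasingToZero (KellerOsserman.radiusZero n f g q) ∧
      KellerOsserman.HasUniversalBound n f g q (fun d =>
        KellerOsserman.inverse (KellerOsserman.radiusZero n f g q) d)) ∧
    (γ < 0 → ¬ KellerOsserman.ConditionNeg f q →
      KellerOsserman.IsDecreasingToZero (KellerOsserman.radiusNeg n f g q) ∧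
      KellerOsserman.HasUniversalBound n f g q (fun d =>
        KellerOsserman.inverse (KellerOsserman.radiusNeg n f g q) d)) := by
  have hle : ∀ t, (g t : EReal) ≤ γ := fun t =>
    ge_of_tendsto hγ ((eventually_ge_atTop t).mono fun s hs =>
      EReal.coe_le_coe_iff.2 (hgmono hs))
  refine ⟨fun h0 hcond => ?_, fun h0 hcond => ?_, fun h0 hcond => ?_⟩
  · have hlim := KellerOsserman.tendsto_atTop_or hγ hfg
    have hpos : ∃ t, 0 < g t := by
      obtain ⟨t, ht⟩ := (hγ.eventually (lt_mem_nhds h0)).exists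
      exact ⟨t, EReal.coe_pos.1 ht⟩
    rcases hq2.lt_or_eq with hlt | rfl
    · exact KellerOsserman.radiusPos_spec_of_lt_two hn hq0 hlt hf hg hfpos hfmono hgmono hlim
        hpos hcond
    · exact KellerOsserman.radiusPos_spec_two hn hf hg hfpos hfmono hgmono hlim hpos
  · subst h0
    exact KellerOsserman.radiusZero_spec hn hq0 hq2 hf hg hfpos hfmono hgmono
      (hfg EReal.zero_lt_top) (fun t => EReal.coe_nonpos.1 (hle t)) hcond
  · exact KellerOsserman.radiusNeg_spec hn hq0 hq2 hf hg hfpos hfmono hgmono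
      (hfg (h0.trans EReal.zero_lt_top)) (fun t => EReal.coe_neg'.1 ((hle t).trans_lt h0)) hcond
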